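/- For a binary sequence $x=(x_i)_{i\ge 1}\in\{0,1\}^{\mathbb N}$ let $L_n(x)$ be the maximal length of a run of consecutive ones among $x_1,\dots,x_n$. Call $x$ typical if $\lim_{n\to\infty}L_n(x)/\log_2 n=1$, and normal if for every $m$ every block $\omega\in\{0,1\}^m$ occurs in $x$ with limiting frequency $2^{-m}$, i.e. $N(x,\omega,n)/n\to 2^{-m}$, where $N(x,\omega,n)$ is the number of occurrences of $\omega$ among the first $n$ digits of $x$. A number $y\in[0,1]$ is called typical (respectively normal) if it has a binary expansion $y=\sum_{i\ge1}x_i2^{-i}$ with $x$ typical (respectively normal). Let $\mathit{TpcN}$ and $\mathit{Normal}$ denote the sets of typical and of normal numbers in $[0,1]$. A subset of a topological space belongs to $D_2(\Pi^0_3)$ if it is of the form $P\setminus Q$ with $P,Q\in\Pi^0_3$. A subset $A$ of a space $X$ is called $D_2(\Pi^0_3)$-complete if $A\in D_2(\Pi^0_3)$, $X\setminus A\notin D_2(\Pi^0_3)$, and for every zero-dimensional Polish space $Z$ and every $B\subseteq Z$ in $D_2(\Pi^0_3)$ there is a continuous $f\colon Z\to X$ with $f^{-1}(A)=B$. Theorem.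 The sets $\mathit{TpcN}\setminus\mathit{Normal}$ and $\mathit{Normal}\setminus\mathit{TpcN}$ are nonempty, and both are $D_2(\Pi^0_3)$-complete, as subsets of $[0,1]$; the corresponding sets of binary sequences are $D_2(\Pi^0_3)$-complete as subsets of $\{0,1\}^{\mathbb N}$. Moreover, let $C$ (respectively $D$) be the set of sequences $a\in\mathbb N^{\mathbb N}$ whose even-indexed (respectively odd-indexed) terms tend to infinity. There is a single continuous map $\varphi\colon\mathbb N^{\mathbb N}\to\{0,1\}^{\mathbb N}$ such that, for every $a\in\mathbb N^{\mathbb N}$, $a\in C\setminus D$ if and only if $\varphi(a)$ is normal and not typical, and $a\in D\setminus C$ if and only if $\varphi(a)$ is typical and not normal. -/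

import Mathlib

open Filter Topology

namespace TypicalNumbers

section BorelHierarchy

variable {X : Type*} [TopologicalSpace X]

/-- `IsSigma0 n A`: the set `A` belongs to the additive Borel class `Σ⁰ₙ(X)` (`n` finite, `n ≥ 1`).
`Σ⁰₁` consists of the open sets; for `n > 1` a set is `Σ⁰ₙ` if it is a countable union of sets
that are complements of `Σ⁰` sets of lower levels. (There is no set of level `0`, so the second
rule produces nothing at levels `0` and `1`.) -/
inductive IsSigma0 : ℕ → Set X → Prop
  | of_isOpen {U : Set X} (hU : IsOpen U) : IsSigma0 1 U
  | iUnion_compl {n : ℕ} {A : Set X} {β : ℕ → ℕ} {B : ℕ → Set X} (hβ : ∀ k, β k < n)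
      (hB : ∀ k, IsSigma0 (β k) (B k)) (hA : A = ⋃ k, (B k)ᶜ) : IsSigma0 n A

/-- `IsPi0 n A`: the set `A` belongs to the multiplicative Borel class `Π⁰ₙ(X)`. -/
def IsPi0 (n : ℕ) (A : Set X) : Prop := IsSigma0 n Aᶜ

/-- `IsD2Pi0 n A`: the set `A` belongs to `D₂(Π⁰ₙ)(X)`, i.e. it is a difference of two
`Π⁰ₙ` subsets of `X`. -/
def IsD2Pi0 (n : ℕ) (A : Set X) : Prop :=
  ∃ P Q : Set X, IsPi0 n P ∧ IsPi0 n Q ∧ A = P \ Q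

/-- `D₂(Π⁰ₙ)`-completeness: `A` lies in the class, its complement does not (so `A` is not in
the dual class), and `A` is hard for the class with respect to continuous reductions from
zero-dimensional Polish spaces. -/
structure IsD2Pi0Complete (n : ℕ) (A : Set X) : Prop where
  mem : IsD2Pi0 n A
  compl_notMem : ¬ IsD2Pi0 n Aᶜ
  hard : ∀ (Z : Type) [TopologicalSpace Z] [PolishSpace Z],
    TopologicalSpace.IsTopologicalBasis {s : Set Z | IsClopen s} →
    ∀ B : Set Z, IsD2Pi0 n B → ∃ f : Z → X, Continuous f ∧ f ⁻¹' A = B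

end BorelHierarchy

/-- The largest length of a run of consecutive ones among the first `n` digits of `x`
(the digits being `x 0, x 1, …`). The set is bounded by `n` and contains `0`. -/
noncomputable def runLength (n : ℕ) (x : ℕ → Fin 2) : ℕ :=
  sSup {j : ℕ | ∃ i : ℕ, i + j ≤ n ∧ ∀ k < j, x (i + k) = 1}

/-- The number of occurrences of the block `w` of length `m` among the first `n` digits of `x`. -/
def blockCount {m : ℕ} (x : ℕ → Fin 2) (w : Fin m → Fin 2) (n : ℕ) : ℕ :=
  ((Finset.range (n + 1)).filter
    (fun i => i + m ≤ n ∧ ∀ k : Fin m, x (i + k) = w k)).card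

/-- The typical binary sequences. -/
def typicalSeq : Set (ℕ → Fin 2) :=
  {x | Tendsto (fun n : ℕ => (runLength n x : ℝ) / Real.logb 2 (n : ℝ)) atTop (𝓝 1)}

/-- The normal binary sequences. -/
def normalSeq : Set (ℕ → Fin 2) :=
  {x | ∀ (m : ℕ) (w : Fin m → Fin 2),
    Tendsto (fun n : ℕ => (blockCount x w n : ℝ) / (n : ℝ)) atTop (𝓝 (1 / 2 ^ m))}

/-- `TpcN`: the numbers in `[0,1]` having a typical binary expansion. -/
def TpcN : Set unitInterval :=
  {y | ∃ x : ℕ → Fin 2, Real.ofDigits x = (y : ℝ) ∧ x ∈ typicalSeq}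

/-- `Normal`: the numbers in `[0,1]` having a binary expansion that is normal in base two. -/
def Normal : Set unitInterval :=
  {y | ∃ x : ℕ → Fin 2, Real.ofDigits x = (y : ℝ) ∧ x ∈ normalSeq}

/-- The sequences of natural numbers whose even-indexed terms tend to infinity. -/
def evenDivergent : Set (ℕ → ℕ) :=
  {a | Tendsto (fun n => a (2 * n)) atTop atTop}

/-- The sequences of natural numbers whose odd-indexed terms tend to infinity. -/
def oddDivergent : Set (ℕ → ℕ) :=
  {a | Tendsto (fun n => a (2 * n + 1)) atTop atTop}

end TypicalNumbers

/-!
Fix a normal sequence `b` and modify it inside each dyadic stage `[2 ^ n, 2 ^ (n + 1))`: plant one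
run of ones of length `n + n / (a (2 n + 1) + 1)`, and replace the digits on a proportion
`1 / (a (2 n) + 1)` of the stage by zeros. The planted runs exceed `n` by a vanishing proportion
exactly when the odd-indexed terms of `a` tend to infinity, and the density of the changed digits
vanishes exactly when the even-indexed terms do, so that the result is typical, respectively normal,
exactly in these cases.

Every pair of `Π⁰₃` subsets of a zero-dimensional Polish space is the preimage, under one continuous
map to `ℕ → ℕ`, of the pair (even terms divergent, odd terms divergent), which gives hardness. That
the complement leaves the class follows by diagonalising against a universal set. The map sending
a sequence to the number it expands is injective off the eventually constant sequences, which are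
countably many and neither typical nor normal, so it transports both sets to `[0, 1]` with their
complexity.
-/

namespace TypicalNumbers

section BorelHierarchy

variable {X Y : Type*} [TopologicalSpace X] [TopologicalSpace Y] {m n : ℕ} {A B : Set X}

theorem not_isSigma0_zero : ¬ IsSigma0 0 A := by
  rintro (_ | ⟨hβ, -, -⟩)
  exact Nat.not_lt_zero _ (hβ 0)

theorem isSigma0_one_iff : IsSigma0 1 A ↔ IsOpen A := by
  refine ⟨?_, .of_isOpen⟩
  rintro (hA | ⟨hβ, hB, -⟩)
  · exact hA
  · exact absurd (Nat.lt_one_iff.1 (hβ 0) ▸ hB 0) not_isSigma0_zero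

theorem isPi0_one_iff : IsPi0 1 A ↔ IsClosed A :=
  isSigma0_one_iff.trans isOpen_compl_iff

theorem isPi0_compl_iff : IsPi0 n Aᶜ ↔ IsSigma0 n A := by
  rw [IsPi0, compl_compl]

theorem isSigma0_of_iUnion {C : ℕ → Set X} (hC : ∀ k, IsPi0 m (C k)) (hmn : m < n) :
    IsSigma0 n (⋃ k, C k) :=
  .iUnion_compl (fun _ => hmn) hC (by simp only [compl_compl])

theorem IsPi0.isSigma0 (hA : IsPi0 m A) (hmn : m < n) : IsSigma0 n A := by
  rw [← Set.iUnion_const (ι := ℕ) A]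
  exact isSigma0_of_iUnion (fun _ => hA) hmn

theorem isSigma0_empty (hn : n ≠ 0) : IsSigma0 n (∅ : Set X) := by
  obtain hn | rfl := (Nat.one_le_iff_ne_zero.2 hn).lt_or_eq
  · exact (isPi0_one_iff.2 isClosed_empty).isSigma0 hn
  · exact .of_isOpen isOpen_empty

theorem isSigma0_univ (hn : n ≠ 0) : IsSigma0 n (Set.univ : Set X) := by
  obtain hn | rfl := (Nat.one_le_iff_ne_zero.2 hn).lt_or_eq
  · exact (isPi0_one_iff.2 isClosed_univ).isSigma0 hn
  · exact .of_isOpen isOpen_univ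

theorem IsSigma0.preimage {A : Set Y} (hA : IsSigma0 n A) {f : X → Y} (hf : Continuous f) :
    IsSigma0 n (f ⁻¹' A) := by
  induction hA with
  | of_isOpen hU => exact .of_isOpen (hU.preimage hf)
  | iUnion_compl hβ _ hA ih => exact .iUnion_compl hβ ih (by simp [hA])

theorem IsPi0.preimage {A : Set Y} (hA : IsPi0 n A) {f : X → Y} (hf : Continuous f) :
    IsPi0 n (f ⁻¹' A) :=
  IsSigma0.preimage (A := Aᶜ) hA hf

theorem IsD2Pi0.preimage {A : Set Y} (hA : IsD2Pi0 n A) {f : X → Y} (hf : Continuous f) :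
    IsD2Pi0 n (f ⁻¹' A) := by
  obtain ⟨P, Q, hP, hQ, rfl⟩ := hA
  exact ⟨_, _, hP.preimage hf, hQ.preimage hf, rfl⟩

theorem isD2Pi0_univ (hn : n ≠ 0) : IsD2Pi0 n (Set.univ : Set X) :=
  ⟨Set.univ, ∅, by simpa only [IsPi0, Set.compl_univ] using isSigma0_empty hn,
    by simpa only [IsPi0, Set.compl_empty] using isSigma0_univ hn, Set.sdiff_empty.symm⟩

theorem isPi0_three_iInter_iUnion {F : ℕ → ℕ → Set X} (hF : ∀ i j, IsClosed (F i j)) :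
    IsPi0 3 (⋂ i, ⋃ j, F i j) := by
  rw [IsPi0, Set.compl_iInter]
  refine isSigma0_of_iUnion (m := 2) (fun i => isPi0_compl_iff.2 ?_) (by norm_num)
  exact isSigma0_of_iUnion (fun j => isPi0_one_iff.2 (hF i j)) (by norm_num)

theorem isPi0_three_compl_of_countable [T1Space X] (hA : A.Countable) : IsPi0 3 Aᶜ := by
  rw [isPi0_compl_iff]
  obtain rfl | hne := A.eq_empty_or_nonempty
  · exact isSigma0_empty (by norm_num)
  · obtain ⟨a, rfl⟩ := hA.exists_eq_range hne
    rw [← Set.iUnion_singleton_eq_range]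
    exact isSigma0_of_iUnion (fun k => isPi0_one_iff.2 (isClosed_singleton (x := a k)))
      (by norm_num)

theorem isPi0_three_setOf_tendsto {M : Type*} [PseudoMetricSpace M] {f : ℕ → X → M} {g : X → M}
    (hf : ∀ n, Continuous (f n)) (hg : Continuous g) :
    IsPi0 3 {x | Tendsto (fun n => f n x) atTop (𝓝 (g x))} := by
  have hset : {x | Tendsto (fun n => f n x) atTop (𝓝 (g x))} =
      ⋂ k : ℕ, ⋃ N : ℕ, ⋂ n ≥ N, {x | dist (f n x) (g x) ≤ 1 / ((k : ℝ) + 1)} := by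
    ext x
    change Tendsto (fun n => f n x) atTop (𝓝 (g x)) ↔ _
    simp only [Metric.nhds_basis_closedBall_inv_nat_succ.tendsto_right_iff, eventually_atTop,
      true_imp_iff, Set.mem_iInter, Set.mem_iUnion, Metric.mem_closedBall, Set.mem_ofPred_eq]
  rw [hset]
  exact isPi0_three_iInter_iUnion fun k N => isClosed_biInter fun n _ =>
    isClosed_le ((hf n).dist hg) continuous_const

variable [PerfectlyNormalSpace X]

theorem exists_eq_iUnion_isClosed (hA : IsOpen A) :
    ∃ F : ℕ → Set X, (∀ k, IsClosed (F k)) ∧ A = ⋃ k, F k := by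
  obtain ⟨U, hU, hAU⟩ := isGδ_iff_eq_iInter_nat.1 hA.isClosed_compl.isGδ
  exact ⟨fun k => (U k)ᶜ, fun k => (hU k).isClosed_compl, by
    rw [← Set.compl_iInter, ← hAU, compl_compl]⟩

theorem IsSigma0.mono (hA : IsSigma0 m A) (hmn : m ≤ n) : IsSigma0 n A := by
  obtain hA | ⟨hβ, hB, rfl⟩ := hA
  · obtain hn | rfl := hmn.lt_or_eq
    · obtain ⟨F, hF, rfl⟩ := exists_eq_iUnion_isClosed hA
      exact isSigma0_of_iUnion (fun k => isPi0_one_iff.2 (hF k)) hn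
    · exact .of_isOpen hA
  · exact .iUnion_compl (fun k => (hβ k).trans_le hmn) hB rfl

theorem isSigma0_succ_iff (hn : n ≠ 0) :
    IsSigma0 (n + 1) A ↔ ∃ C : ℕ → Set X, (∀ k, IsPi0 n (C k)) ∧ A = ⋃ k, C k := by
  refine ⟨?_, fun ⟨C, hC, h⟩ => h ▸ isSigma0_of_iUnion hC n.lt_succ_self⟩
  rintro (_ | @⟨_, _, β, B, hβ, hB, hA⟩)
  · exact absurd rfl hn
  · exact ⟨fun k => (B k)ᶜ,
      fun k => isPi0_compl_iff.2 ((hB k).mono (Nat.lt_succ_iff.1 (hβ k))), hA⟩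

theorem IsSigma0.iUnion {ι : Type*} [Countable ι] [Nonempty ι] {A : ι → Set X}
    (hA : ∀ i, IsSigma0 n (A i)) : IsSigma0 n (⋃ i, A i) := by
  obtain rfl | rfl | n := n
  · exact absurd (hA (Classical.arbitrary ι)) not_isSigma0_zero
  · exact .of_isOpen (isOpen_iUnion fun i => isSigma0_one_iff.1 (hA i))
  · choose C hC hAC using fun i => (isSigma0_succ_iff n.succ_ne_zero).1 (hA i)
    obtain ⟨g, hg⟩ := exists_surjective_nat (ι × ℕ)
    refine (isSigma0_succ_iff n.succ_ne_zero).2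
      ⟨fun p => C (g p).1 (g p).2, fun p => hC _ _, ?_⟩
    rw [hg.iUnion_comp (fun p => C p.1 p.2), Set.iUnion_prod']
    exact Set.iUnion_congr hAC

theorem IsPi0.iInter {ι : Type*} [Countable ι] [Nonempty ι] {A : ι → Set X}
    (hA : ∀ i, IsPi0 n (A i)) : IsPi0 n (⋂ i, A i) := by
  rw [IsPi0, Set.compl_iInter]
  exact IsSigma0.iUnion hA

theorem IsPi0.inter (hA : IsPi0 n A) (hB : IsPi0 n B) : IsPi0 n (A ∩ B) := by
  rw [Set.inter_eq_iInter]
  exact IsPi0.iInter (Bool.forall_bool.2 ⟨hB, hA⟩)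

theorem isPi0_three_iff :
    IsPi0 3 A ↔ ∃ F : ℕ → ℕ → Set X, (∀ i j, IsClosed (F i j)) ∧ A = ⋂ i, ⋃ j, F i j := by
  refine ⟨fun hA => ?_, fun ⟨F, hF, h⟩ => h ▸ isPi0_three_iInter_iUnion hF⟩
  obtain ⟨C, hC, hAC⟩ := (isSigma0_succ_iff two_ne_zero).1 hA
  choose F hF hCF using fun i => (isSigma0_succ_iff one_ne_zero).1 (hC i)
  refine ⟨F, fun i j => isPi0_one_iff.1 (hF i j), ?_⟩
  rw [← compl_inj_iff, hAC, Set.compl_iInter]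
  exact Set.iUnion_congr fun i => by rw [← hCF, compl_compl]

end BorelHierarchy

section Interleave

variable {α : Type*}

/-- The sequence `a 0, b 0, a 1, b 1, …`; it codes two sequences by one. -/
def interleave (a b : ℕ → α) (n : ℕ) : α :=
  if n % 2 = 0 then a (n / 2) else b (n / 2)

@[simp]
theorem interleave_two_mul (a b : ℕ → α) (n : ℕ) : interleave a b (2 * n) = a n := by
  rw [interleave, if_pos (by omega), Nat.mul_div_cancel_left n two_pos]

@[simp]
theorem interleave_two_mul_add_one (a b : ℕ → α) (n : ℕ) :
    interleave a b (2 * n + 1) = b n := by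
  rw [interleave, if_neg (by omega), show (2 * n + 1) / 2 = n by omega]

theorem continuous_interleave {X : Type*} [TopologicalSpace X] [TopologicalSpace α]
    {f g : X → ℕ → α} (hf : Continuous f) (hg : Continuous g) :
    Continuous fun x => interleave (f x) (g x) := by
  refine continuous_pi fun n => ?_
  unfold interleave
  split_ifs
  · exact (continuous_apply _).comp hf
  · exact (continuous_apply _).comp hg

end Interleave

section Diagonal

variable {X : Type*} [TopologicalSpace X] {n : ℕ}

theorem exists_seq_mem_basis_eq_iUnion [SecondCountableTopology X] {𝓑 : Set (Set X)}
    (h𝓑 : TopologicalSpace.IsTopologicalBasis 𝓑) (hempty : ∅ ∈ 𝓑) {U : Set X} (hU : IsOpen U) :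
    ∃ V : ℕ → Set X, (∀ k, V k ∈ 𝓑) ∧ U = ⋃ k, V k := by
  obtain ⟨S, hS, rfl⟩ := h𝓑.open_eq_sUnion hU
  obtain ⟨T, hT, hTS, hTU⟩ :=
    TopologicalSpace.isOpen_sUnion_countable S fun s hs => h𝓑.isOpen (hS hs)
  obtain ⟨V, hV⟩ := (hT.insert ∅).exists_eq_range (Set.insert_nonempty _ _)
  refine ⟨V, fun k => ?_, ?_⟩
  · exact Set.insert_subset hempty (hTS.trans hS) (hV ▸ Set.mem_range_self k)
  · rw [← Set.sUnion_range, ← hV, Set.sUnion_insert, Set.empty_union, hTU]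

theorem exists_seq_isOpen_forall_isOpen_eq_iUnion (X : Type*) [TopologicalSpace X]
    [SecondCountableTopology X] :
    ∃ V : ℕ → Set X, (∀ k, IsOpen (V k)) ∧
      ∀ U, IsOpen U → ∃ e : ℕ → ℕ, U = ⋃ k, V (e k) := by
  have hbasis := (TopologicalSpace.isBasis_countableBasis X).insert_empty
  obtain ⟨V, hV⟩ := ((TopologicalSpace.countable_countableBasis X).insert ∅).exists_eq_range
    (Set.insert_nonempty _ _)
  refine ⟨V, fun k => hbasis.isOpen (hV ▸ Set.mem_range_self k), fun U hU => ?_⟩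
  obtain ⟨V', hV', hUV'⟩ := exists_seq_mem_basis_eq_iUnion hbasis (Set.mem_insert _ _) hU
  choose e he using fun k => (hV ▸ hV' k : V' k ∈ Set.range V)
  exact ⟨e, by simp only [he, hUV']⟩

theorem exists_universal_isSigma0_one [SecondCountableTopology X] :
    ∃ W : Set ((ℕ → ℕ) × X), IsSigma0 1 W ∧
      ∀ A : Set X, IsSigma0 1 A → ∃ e : ℕ → ℕ, Prod.mk e ⁻¹' W = A := by
  obtain ⟨V, hV, hVU⟩ := exists_seq_isOpen_forall_isOpen_eq_iUnion X
  refine ⟨⋃ (k : ℕ) (c : ℕ), {e : ℕ → ℕ | e k = c} ×ˢ V c, .of_isOpen ?_, fun A hA => ?_⟩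
  · exact isOpen_iUnion fun k => isOpen_iUnion fun c =>
      ((isOpen_discrete {c}).preimage (continuous_apply (A := fun _ : ℕ => ℕ) k)).prod (hV c)
  · obtain ⟨e, rfl⟩ := hVU A (isSigma0_one_iff.1 hA)
    refine ⟨e, ?_⟩
    ext x
    simp

theorem exists_universal_isSigma0 [SecondCountableTopology X] [PerfectlyNormalSpace X]
    (hn : n ≠ 0) :
    ∃ W : Set ((ℕ → ℕ) × X), IsSigma0 n W ∧
      ∀ A : Set X, IsSigma0 n A → ∃ e : ℕ → ℕ, Prod.mk e ⁻¹' W = A := by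
  induction n, Nat.one_le_iff_ne_zero.2 hn using Nat.le_induction with
  | base => exact exists_universal_isSigma0_one
  | succ n hn' ih =>
    have hn0 := Nat.one_le_iff_ne_zero.1 hn'
    obtain ⟨W, hW, hWA⟩ := ih hn0
    let slice (k : ℕ) (p : (ℕ → ℕ) × X) : (ℕ → ℕ) × X := (fun i => p.1 (Nat.pair k i), p.2)
    have hslice (k : ℕ) : Continuous (slice k) := by fun_prop
    refine ⟨⋃ k, slice k ⁻¹' Wᶜ, isSigma0_of_iUnion (m := n) (fun k => ?_) n.lt_succ_self,
      fun A hA => ?_⟩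
    · exact (isPi0_compl_iff.2 hW).preimage (hslice k)
    · obtain ⟨C, hC, rfl⟩ := (isSigma0_succ_iff hn0).1 hA
      choose e he using fun k => hWA _ (hC k)
      refine ⟨fun p => e p.unpair.1 p.unpair.2, ?_⟩
      rw [Set.preimage_iUnion]
      refine Set.iUnion_congr fun k => ?_
      rw [← compl_compl (C k), ← he k]
      ext x
      simp [slice]

theorem exists_isD2Pi0_not_isD2Pi0_compl (hn : n ≠ 0) :
    ∃ B : Set (ℕ → ℕ), IsD2Pi0 n B ∧ ¬ IsD2Pi0 n Bᶜ := by
  obtain ⟨W, hW, hWA⟩ := exists_universal_isSigma0 (X := ℕ → ℕ) hn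
  let decode₀ (x : ℕ → ℕ) : (ℕ → ℕ) × (ℕ → ℕ) := (fun i => x (2 * i), x)
  let decode₁ (x : ℕ → ℕ) : (ℕ → ℕ) × (ℕ → ℕ) := (fun i => x (2 * i + 1), x)
  have hdecode₀ : Continuous decode₀ := by fun_prop
  have hdecode₁ : Continuous decode₁ := by fun_prop
  have hW' : IsPi0 n Wᶜ := isPi0_compl_iff.2 hW
  refine ⟨decode₀ ⁻¹' Wᶜ \ decode₁ ⁻¹' Wᶜ,
    ⟨_, _, hW'.preimage hdecode₀, hW'.preimage hdecode₁, rfl⟩, ?_⟩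
  rintro ⟨P, Q, hP, hQ, hPQ⟩
  obtain ⟨a, ha⟩ := hWA _ hP
  obtain ⟨b, hb⟩ := hWA _ hQ
  have hPx : decode₀ (interleave a b) ∈ Wᶜ ↔ interleave a b ∈ P := by
    rw [← compl_compl P, ← ha]
    simp [decode₀]
  have hQx : decode₁ (interleave a b) ∈ Wᶜ ↔ interleave a b ∈ Q := by
    rw [← compl_compl Q, ← hb]
    simp [decode₁]
  have hcompl := Set.ext_iff.1 hPQ (interleave a b)
  rw [Set.mem_compl_iff, Set.mem_sdiff, Set.mem_sdiff, Set.mem_preimage, Set.mem_preimage, hPx,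
    hQx] at hcompl
  exact not_iff_self hcompl

theorem isTopologicalBasis_isClopen_pi {ι : Type*} {α : ι → Type*}
    [∀ i, TopologicalSpace (α i)] [∀ i, DiscreteTopology (α i)] :
    TopologicalSpace.IsTopologicalBasis {s : Set (∀ i, α i) | IsClopen s} := by
  refine TopologicalSpace.isTopologicalBasis_of_isOpen_of_nhds (fun s hs => hs.isOpen) ?_
  intro x U hx hU
  obtain ⟨_, ⟨V, F, -, rfl⟩, hxV, hVU⟩ :=
    (isTopologicalBasis_pi fun i =>
      TopologicalSpace.isTopologicalBasis_opens (α := α i)).exists_subset_of_mem_open hx hU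
  exact ⟨_, ⟨isClosed_set_pi fun _ _ => isClosed_discrete _,
    isOpen_set_pi F.finite_toSet fun _ _ => isOpen_discrete _⟩, hxV, hVU⟩

theorem IsD2Pi0.ne_zero {A : Set X} (hA : IsD2Pi0 n A) : n ≠ 0 := by
  rintro rfl
  obtain ⟨P, _, hP, -⟩ := hA
  exact not_isSigma0_zero hP

theorem IsD2Pi0Complete.of_hard {A : Set X} (hA : IsD2Pi0 n A)
    (hard : ∀ (Z : Type) [TopologicalSpace Z] [PolishSpace Z],
      TopologicalSpace.IsTopologicalBasis {s : Set Z | IsClopen s} →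
      ∀ B : Set Z, IsD2Pi0 n B → ∃ f : Z → X, Continuous f ∧ f ⁻¹' A = B) :
    IsD2Pi0Complete n A := by
  refine ⟨hA, fun hAc => ?_, hard⟩
  obtain ⟨B, hB, hBc⟩ := exists_isD2Pi0_not_isD2Pi0_compl hA.ne_zero
  obtain ⟨f, hf, rfl⟩ := hard (ℕ → ℕ) isTopologicalBasis_isClopen_pi B hB
  exact hBc (hAc.preimage hf)

theorem IsD2Pi0Complete.nonempty {A : Set X} (hA : IsD2Pi0Complete n A) : A.Nonempty := by
  rw [Set.nonempty_iff_ne_empty]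
  rintro rfl
  exact hA.compl_notMem (Set.compl_empty ▸ isD2Pi0_univ hA.mem.ne_zero)

end Diagonal

section Reduction

variable {Z : Type*} {U : ℕ → ℕ → Set Z} {z : Z} {j k : ℕ}

/-- The least `k` that survives the first `j` tests `z ∈ U k i`, `i < j`, where only the
candidates `k < j` are tested. It is a conjecture, made at time `j`, about the index of an
intersection `⋂ i, U k i` containing `z`. -/
noncomputable def leastSurvivor (U : ℕ → ℕ → Set Z) (z : Z) (j : ℕ) : ℕ :=
  sInf {k | k < j → ∀ i < j, z ∈ U k i}

theorem leastSurvivor_spec (U : ℕ → ℕ → Set Z) (z : Z) (j : ℕ) :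
    leastSurvivor U z j < j → ∀ i < j, z ∈ U (leastSurvivor U z j) i :=
  Nat.sInf_mem (s := {k | k < j → ∀ i < j, z ∈ U k i}) ⟨j, fun h => absurd h (lt_irrefl j)⟩

theorem leastSurvivor_le (hk : ∀ i, z ∈ U k i) (j : ℕ) : leastSurvivor U z j ≤ k :=
  Nat.sInf_le fun _ i _ => hk i

theorem monotone_leastSurvivor (U : ℕ → ℕ → Set Z) (z : Z) : Monotone (leastSurvivor U z) :=
  fun _ j' hjj' => Nat.sInf_le fun hlt i hi =>
    leastSurvivor_spec U z j' (hlt.trans_le hjj') i (hi.trans_le hjj')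

theorem eventually_leastSurvivor_succ_eq_iff :
    (∀ᶠ j in atTop, leastSurvivor U z (j + 1) = leastSurvivor U z j) ↔
      z ∈ ⋃ k, ⋂ i, U k i := by
  simp only [Set.mem_iUnion, Set.mem_iInter]
  constructor
  · intro hconst
    obtain ⟨N, hN⟩ := eventually_atTop.1 hconst
    have hsettled : ∀ j ≥ N, leastSurvivor U z j = leastSurvivor U z N := fun j hj =>
      Nat.le_induction rfl (fun j hj ih => (hN j hj).trans ih) j hj
    refine ⟨leastSurvivor U z N, fun i => ?_⟩
    have hspec := leastSurvivor_spec U z (N + leastSurvivor U z N + i + 1)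
    rw [hsettled _ (by omega)] at hspec
    exact hspec (by omega) i (by omega)
  · rintro ⟨k, hk⟩
    obtain ⟨c, N, hc⟩ :=
      converges_of_monotone_of_bounded (monotone_leastSurvivor U z) (leastSurvivor_le hk)
    filter_upwards [eventually_ge_atTop N] with j hj
    rw [hc j hj, hc (j + 1) (hj.trans j.le_succ)]

theorem tendsto_unpair_ite_iff {p : ℕ → ℕ → Prop} [∀ n j, Decidable (p n j)] :
    Tendsto (fun m : ℕ => if p m.unpair.1 m.unpair.2 then m.unpair.1 + m.unpair.2 else m.unpair.1)
      atTop atTop ↔ ∀ n, ∀ᶠ j in atTop, p n j := by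
  constructor
  · intro h n
    obtain ⟨N, hN⟩ := eventually_atTop.1 (h.eventually_gt_atTop n)
    filter_upwards [eventually_ge_atTop N] with j hj
    by_contra hp
    simpa [hp] using hN (Nat.pair n j) (hj.trans (Nat.right_le_pair n j))
  · intro h
    have hcofinite : Tendsto (fun q : ℕ × ℕ => if p q.1 q.2 then q.1 + q.2 else q.1)
        cofinite atTop := by
      refine tendsto_atTop.2 fun M => eventually_cofinite.2 ?_
      have hrow (n : ℕ) : {j | ¬ (p n j ∧ M ≤ j)}.Finite := by
        rw [← eventually_cofinite, Nat.cofinite_eq_atTop]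
        exact (h n).and (eventually_ge_atTop M)
      refine ((Set.finite_Iio M).biUnion fun n _ => (hrow n).image (Prod.mk n)).subset ?_
      rintro ⟨n, j⟩ hq
      have hq : ¬ M ≤ if p n j then n + j else n := hq
      refine Set.mem_biUnion (x := n) ?_ ⟨j, ?_, rfl⟩
      · rw [Set.mem_Iio]
        split_ifs at hq <;> omega
      · rintro ⟨hp, hj⟩
        rw [if_pos hp] at hq
        omega
    rw [← Nat.cofinite_eq_atTop] at hcofinite ⊢
    exact hcofinite.comp Nat.pairEquiv.symm.injective.tendsto_cofinite

variable [TopologicalSpace Z]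

theorem eventually_mem_iff_of_isClopen {S : Set Z} (hS : IsClopen S) (z : Z) :
    ∀ᶠ y in 𝓝 z, (y ∈ S ↔ z ∈ S) := by
  by_cases hz : z ∈ S
  · filter_upwards [hS.isOpen.mem_nhds hz] with y hy using iff_of_true hy hz
  · filter_upwards [hS.compl.isOpen.mem_nhds hz] with y hy using iff_of_false hy hz

theorem continuous_leastSurvivor (hU : ∀ k i, IsClopen (U k i)) (j : ℕ) :
    Continuous fun z => leastSurvivor U z j := by
  refine ((IsLocallyConstant.iff_eventually_eq _).2 fun z => ?_).continuous
  have htests : ∀ᶠ y in 𝓝 z, ∀ k ∈ Set.Iio j, ∀ i ∈ Set.Iio j, (y ∈ U k i ↔ z ∈ U k i) :=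
    (eventually_all_finite (Set.finite_Iio j)).2 fun k _ =>
      (eventually_all_finite (Set.finite_Iio j)).2 fun i _ =>
        eventually_mem_iff_of_isClopen (hU k i) z
  filter_upwards [htests] with y hy
  refine congrArg sInf (Set.ext fun k => forall_congr' fun hk => ?_)
  exact forall₂_congr fun i hi => hy k hk i hi

theorem exists_isClopen_eq_iInter [SecondCountableTopology Z]
    (hZ : TopologicalSpace.IsTopologicalBasis {s : Set Z | IsClopen s}) {F : Set Z}
    (hF : IsClosed F) : ∃ V : ℕ → Set Z, (∀ i, IsClopen (V i)) ∧ F = ⋂ i, V i := by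
  obtain ⟨V, hV, hFV⟩ := exists_seq_mem_basis_eq_iUnion hZ isClopen_empty hF.isOpen_compl
  refine ⟨fun i => (V i)ᶜ, fun i => IsClopen.compl (hV i), ?_⟩
  rw [← Set.compl_iUnion, ← hFV, compl_compl]

theorem exists_continuous_tendsto_atTop_iff [SecondCountableTopology Z]
    [PerfectlyNormalSpace Z]
    (hZ : TopologicalSpace.IsTopologicalBasis {s : Set Z | IsClopen s}) {P : Set Z}
    (hP : IsPi0 3 P) :
    ∃ f : Z → ℕ → ℕ, Continuous f ∧ ∀ z, Tendsto (f z) atTop atTop ↔ z ∈ P := by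
  obtain ⟨F, hF, rfl⟩ := isPi0_three_iff.1 hP
  choose U hU hFU using fun n k => exists_isClopen_eq_iInter hZ (hF n k)
  let stable (n j : ℕ) (z : Z) : Prop :=
    leastSurvivor (U n) z (j + 1) = leastSurvivor (U n) z j
  have hstable (n j : ℕ) : IsClopen {z | stable n j z} :=
    (isClopen_discrete {p : ℕ × ℕ | p.1 = p.2}).preimage
      ((continuous_leastSurvivor (hU n) (j + 1)).prodMk (continuous_leastSurvivor (hU n) j))
  classical
  refine ⟨fun z m => if stable m.unpair.1 m.unpair.2 z then m.unpair.1 + m.unpair.2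
    else m.unpair.1, continuous_pi fun m => ?_, fun z => ?_⟩
  · refine continuous_if (fun z hz => ?_) continuousOn_const continuousOn_const
    rw [(hstable _ _).frontier_eq] at hz
    exact hz.elim
  · rw [tendsto_unpair_ite_iff (p := fun n j => stable n j z), Set.mem_iInter]
    refine forall_congr' fun n => ?_
    simp only [stable, eventually_leastSurvivor_succ_eq_iff, hFU]

end Reduction

section HardPair

variable {X Y : Type*} [TopologicalSpace X] [TopologicalSpace Y] {n : ℕ} {S T : Set X}

/-- The pair `(S, T)` is hard for pairs of `Π⁰ₙ` sets: any two `Π⁰ₙ` subsets of a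
zero-dimensional Polish space are simultaneously the preimages of `S` and `T` under one
continuous map. -/
def IsPi0HardPair (n : ℕ) (S T : Set X) : Prop :=
  ∀ (Z : Type) [TopologicalSpace Z] [PolishSpace Z],
    TopologicalSpace.IsTopologicalBasis {s : Set Z | IsClopen s} →
    ∀ P Q : Set Z, IsPi0 n P → IsPi0 n Q →
      ∃ f : Z → X, Continuous f ∧ f ⁻¹' S = P ∧ f ⁻¹' T = Q

theorem IsPi0HardPair.symm (h : IsPi0HardPair n S T) : IsPi0HardPair n T S :=
  fun Z _ _ hZ P Q hP hQ => by
    obtain ⟨f, hf, hfQ, hfP⟩ := h Z hZ Q P hQ hP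
    exact ⟨f, hf, hfP, hfQ⟩

theorem IsPi0HardPair.of_preimage {S T : Set Y} {φ : X → Y} (hφ : Continuous φ)
    (h : IsPi0HardPair n (φ ⁻¹' S) (φ ⁻¹' T)) : IsPi0HardPair n S T :=
  fun Z _ _ hZ P Q hP hQ => by
    obtain ⟨f, hf, hfP, hfQ⟩ := h Z hZ P Q hP hQ
    exact ⟨φ ∘ f, hφ.comp hf, hfP, hfQ⟩

theorem IsPi0HardPair.isD2Pi0Complete_sdiff (h : IsPi0HardPair n S T) (hS : IsPi0 n S)
    (hT : IsPi0 n T) : IsD2Pi0Complete n (S \ T) := by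
  refine .of_hard ⟨S, T, hS, hT, rfl⟩ ?_
  rintro Z _ _ hZ _ ⟨P, Q, hP, hQ, rfl⟩
  obtain ⟨f, hf, rfl, rfl⟩ := h Z hZ P Q hP hQ
  exact ⟨f, hf, rfl⟩

theorem isPi0HardPair_divergent : IsPi0HardPair 3 evenDivergent oddDivergent := by
  intro Z _ _ hZ P Q hP hQ
  let _ := TopologicalSpace.upgradeIsCompletelyMetrizable Z
  obtain ⟨f, hf, hfP⟩ := exists_continuous_tendsto_atTop_iff hZ hP
  obtain ⟨g, hg, hgQ⟩ := exists_continuous_tendsto_atTop_iff hZ hQ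
  refine ⟨fun z => interleave (f z) (g z), continuous_interleave hf hg, ?_, ?_⟩
  · ext z
    simp [evenDivergent, hfP]
  · ext z
    simp [oddDivergent, hgQ]

end HardPair

section Statistics

variable {x : ℕ → Fin 2} {m n : ℕ}

theorem count_le_of_forall_lt {p : ℕ → Prop} [DecidablePred p] {k : ℕ}
    (h : ∀ i < n, p i → i < k) : Nat.count p n ≤ k := by
  rw [Nat.count_eq_card_filter_range, ← Finset.card_range k]
  refine Finset.card_le_card fun i hi => ?_
  rw [Finset.mem_filter, Finset.mem_range] at hi
  exact Finset.mem_range.2 (h i hi.1 hi.2)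

theorem le_runLength {i j : ℕ} (hij : i + j ≤ n) (h : ∀ k < j, x (i + k) = 1) :
    j ≤ runLength n x :=
  le_csSup ⟨n, by rintro j ⟨i, hij, -⟩; omega⟩ ⟨i, hij, h⟩

theorem runLength_le {B : ℕ} (h : ∀ i j, i + j ≤ n → (∀ k < j, x (i + k) = 1) → j ≤ B) :
    runLength n x ≤ B :=
  csSup_le ⟨0, 0, n.zero_le, by simp⟩ fun j ⟨i, hij, hj⟩ => h i j hij hj

theorem blockCount_eq_count (x : ℕ → Fin 2) (w : Fin m → Fin 2) (n : ℕ) :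
    blockCount x w n = Nat.count (fun i => ∀ k : Fin m, x (i + k) = w k) (n + 1 - m) := by
  rw [blockCount, Nat.count_eq_card_filter_range]
  congr 1
  ext i
  simp only [Finset.mem_filter, Finset.mem_range, ← and_assoc]
  exact and_congr_left' (by omega)

theorem tendsto_count_digit_of_mem_normalSeq (hx : x ∈ normalSeq) (d : Fin 2) :
    Tendsto (fun n : ℕ => (Nat.count (x · = d) n : ℝ) / n) atTop (𝓝 (1 / 2)) := by
  simpa [blockCount_eq_count] using hx 1 fun _ => d

theorem tendsto_logb_natCast_atTop :
    Tendsto (fun n : ℕ => Real.logb 2 n) atTop atTop :=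
  (Real.tendsto_logb_atTop one_lt_two).comp tendsto_natCast_atTop_atTop

theorem tendsto_logb_div_natCast :
    Tendsto (fun n : ℕ => Real.logb 2 n / n) atTop (𝓝 0) := by
  have h := (Real.isLittleO_log_id_atTop.tendsto_div_nhds_zero.comp
    tendsto_natCast_atTop_atTop).div_const (Real.log 2)
  rw [zero_div] at h
  exact h.congr fun n => div_right_comm _ _ _

theorem tendsto_runLength_atTop_of_mem_typicalSeq (hx : x ∈ typicalSeq) :
    Tendsto (fun n => (runLength n x : ℝ)) atTop atTop := by
  refine (Tendsto.pos_mul_atTop one_pos hx tendsto_logb_natCast_atTop).congr' ?_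
  filter_upwards [tendsto_logb_natCast_atTop.eventually_ne_atTop 0] with n hn
  exact div_mul_cancel₀ _ hn

theorem tendsto_runLength_div_natCast_of_mem_typicalSeq (hx : x ∈ typicalSeq) :
    Tendsto (fun n => (runLength n x : ℝ) / n) atTop (𝓝 0) := by
  rw [← one_mul (0 : ℝ)]
  refine (Tendsto.mul hx tendsto_logb_div_natCast).congr' ?_
  filter_upwards [tendsto_logb_natCast_atTop.eventually_ne_atTop 0] with n hn
  exact div_mul_div_cancel₀ hn

theorem not_eventuallyConst_of_mem_normalSeq (hx : x ∈ normalSeq) :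
    ¬ EventuallyConst x atTop := by
  rw [eventuallyConst_atTop]
  rintro ⟨N, hN⟩
  have hbound (n : ℕ) : Nat.count (x · = x N + 1) n ≤ N :=
    count_le_of_forall_lt fun i _ hi => by
      by_contra! hNi
      have := hN i hNi
      omega
  have hlim : Tendsto (fun n : ℕ => (N : ℝ) / n) atTop (𝓝 0) :=
    tendsto_const_nhds.div_atTop tendsto_natCast_atTop_atTop
  have hle := le_of_tendsto_of_tendsto' (tendsto_count_digit_of_mem_normalSeq hx (x N + 1)) hlim
    fun n => by gcongr; exact hbound n
  norm_num at hle

theorem not_eventuallyConst_of_mem_typicalSeq (hx : x ∈ typicalSeq) :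
    ¬ EventuallyConst x atTop := by
  rw [eventuallyConst_atTop]
  rintro ⟨N, hN⟩
  obtain hN0 | hN1 : x N = 0 ∨ x N = 1 := by omega
  · obtain ⟨n, hn⟩ := ((tendsto_runLength_atTop_of_mem_typicalSeq hx).eventually_gt_atTop
      (N : ℝ)).exists
    refine (Nat.cast_lt.1 hn).not_ge (runLength_le fun i j _ hj => ?_)
    by_contra! hNj
    have h0 := hN (i + N) (by omega)
    have h1 := hj N hNj
    omega
  · have hlim : Tendsto (fun n : ℕ => 1 - (N : ℝ) / n) atTop (𝓝 (1 - 0)) :=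
      tendsto_const_nhds.sub (tendsto_const_nhds.div_atTop tendsto_natCast_atTop_atTop)
    have hle := le_of_tendsto_of_tendsto hlim
      (tendsto_runLength_div_natCast_of_mem_typicalSeq hx) ?_
    · norm_num at hle
    filter_upwards [eventually_gt_atTop N] with n hn
    have hrun : n - N ≤ runLength n x :=
      le_runLength (i := N) (by omega) fun k _ => (hN _ (by omega)).trans hN1
    have hpos : (0 : ℝ) < n := Nat.cast_pos.2 (by omega)
    rw [one_sub_div hpos.ne', sub_eq_add_neg]
    gcongr
    rw [← sub_eq_add_neg, ← Nat.cast_sub hn.le]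
    exact_mod_cast hrun

end Statistics

section Complexity

variable {m : ℕ}

theorem continuous_of_dependsOn_finite {ι β : Type*} {α : ι → Type*}
    [∀ i, TopologicalSpace (α i)] [∀ i, DiscreteTopology (α i)] [TopologicalSpace β]
    {f : (∀ i, α i) → β} {s : Set ι} (hf : DependsOn f s) (hs : s.Finite) : Continuous f := by
  refine ((IsLocallyConstant.iff_eventually_eq f).2 fun x => ?_).continuous
  have hcoord : ∀ᶠ y in 𝓝 x, ∀ i ∈ s, y i = x i :=
    (eventually_all_finite hs).2 fun i _ =>
      (continuous_apply i).continuousAt.eventually_mem ((isOpen_discrete {x i}).mem_nhds rfl)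
  filter_upwards [hcoord] with y hy using hf hy

theorem continuous_runLength (n : ℕ) : Continuous (runLength n) := by
  refine continuous_of_dependsOn_finite (s := Set.Iio n) (fun x y hxy => ?_) (Set.finite_Iio n)
  refine congrArg sSup (Set.ext fun j => exists_congr fun i => and_congr_right fun hij => ?_)
  exact forall₂_congr fun k hk => by rw [hxy (i + k) (Set.mem_Iio.2 (by omega))]

theorem continuous_blockCount (w : Fin m → Fin 2) (n : ℕ) :
    Continuous fun x => blockCount x w n := by
  refine continuous_of_dependsOn_finite (s := Set.Iio n) (fun x y hxy => ?_) (Set.finite_Iio n)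
  refine congrArg Finset.card (Finset.filter_congr fun i _ => and_congr_right fun him => ?_)
  exact forall_congr' fun k => by rw [hxy (i + k) (Set.mem_Iio.2 (by omega))]

theorem isPi0_typicalSeq : IsPi0 3 typicalSeq :=
  isPi0_three_setOf_tendsto (fun n => (continuous_of_discreteTopology
    (f := fun r : ℕ => (r : ℝ) / Real.logb 2 n)).comp (continuous_runLength n)) continuous_const

theorem isPi0_normalSeq : IsPi0 3 normalSeq := by
  have hset : normalSeq = ⋂ p : Σ m : ℕ, (Fin m → Fin 2),
      {x | Tendsto (fun n => (blockCount x p.2 n : ℝ) / n) atTop (𝓝 (1 / 2 ^ p.1))} := by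
    ext x
    simp only [normalSeq, Set.mem_ofPred_eq, Set.mem_iInter, Sigma.forall]
  rw [hset]
  exact .iInter fun p => isPi0_three_setOf_tendsto (fun n => (continuous_of_discreteTopology
    (f := fun r : ℕ => (r : ℝ) / n)).comp (continuous_blockCount p.2 n)) continuous_const

end Complexity

section InjectiveOff

variable {X Y : Type*} {f : X → Y} {E T : Set X}

/-- The map `f` is injective except that it may identify points of the exceptional set `E` with
one another. -/
def InjectiveOff (f : X → Y) (E : Set X) : Prop :=
  ∀ ⦃x y⦄, f x = f y → x = y ∨ x ∈ E ∧ y ∈ E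

theorem InjectiveOff.mem_image_iff (hf : InjectiveOff f E) {x : X} (hx : x ∉ E) {A : Set X} :
    f x ∈ f '' A ↔ x ∈ A := by
  refine ⟨?_, Set.mem_image_of_mem f⟩
  rintro ⟨y, hy, hyx⟩
  obtain rfl | ⟨-, hxE⟩ := hf hyx
  · exact hy
  · exact absurd hxE hx

theorem InjectiveOff.preimage_image (hf : InjectiveOff f E) (hT : Disjoint T E) :
    f ⁻¹' (f '' T) = T := by
  refine subset_antisymm ?_ (Set.subset_preimage_image f T)
  rintro x ⟨y, hy, hyx⟩
  obtain rfl | ⟨hyE, -⟩ := hf hyx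
  · exact hy
  · exact absurd hyE (Set.disjoint_left.1 hT hy)

theorem InjectiveOff.image_iInter_iUnion (hf : InjectiveOff f E)
    (hsurj : Function.Surjective f) {F : ℕ → ℕ → Set X} (hF : Disjoint (⋂ i, ⋃ j, F i j) E) :
    f '' (⋂ i, ⋃ j, F i j) = (⋂ i, ⋃ j, f '' F i j) ∩ (f '' E)ᶜ := by
  ext y
  obtain ⟨x, rfl⟩ := hsurj y
  by_cases hx : x ∈ E
  · refine iff_of_false ?_ fun h => h.2 (Set.mem_image_of_mem f hx)
    exact fun h => Set.disjoint_left.1 hF (hf.preimage_image hF ▸ h) hx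
  · simp only [Set.mem_inter_iff, Set.mem_iInter, Set.mem_iUnion, Set.mem_compl_iff,
      hf.mem_image_iff hx, hx, not_false_eq_true, and_true]

theorem InjectiveOff.isPi0_three_image [TopologicalSpace X] [TopologicalSpace Y]
    [PerfectlyNormalSpace X] [T6Space Y] (hf : InjectiveOff f E) (hclosed : IsClosedMap f)
    (hsurj : Function.Surjective f) (hE : E.Countable) (hT : IsPi0 3 T) (hTE : Disjoint T E) :
    IsPi0 3 (f '' T) := by
  obtain ⟨F, hF, rfl⟩ := isPi0_three_iff.1 hT
  rw [hf.image_iInter_iUnion hsurj hTE]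
  exact (isPi0_three_iInter_iUnion fun i j => hclosed _ (hF i j)).inter
    (isPi0_three_compl_of_countable (hE.image f))

end InjectiveOff

section Digits

variable {b : ℕ}

theorem countable_setOf_eventuallyConst {α : Type*} [Countable α] :
    {x : ℕ → α | EventuallyConst x atTop}.Countable := by
  have hsub : {x : ℕ → α | EventuallyConst x atTop} ⊆ ⋃ N : ℕ,
      Set.range fun (p : Fin (N + 1) → α) i =>
        p ⟨min i N, Nat.lt_succ_of_le (min_le_right i N)⟩ := by
    intro x hx
    obtain ⟨N, hN⟩ := eventuallyConst_atTop.1 hx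
    refine Set.mem_iUnion.2 ⟨N, fun i => x i, funext fun i => ?_⟩
    obtain hi | hi := le_total i N
    · exact congrArg x (min_eq_left hi)
    · exact (congrArg x (min_eq_right hi)).trans (hN i hi).symm
  exact (Set.countable_iUnion fun N => Set.countable_range _).mono hsub

theorem strictMono_ofDigits : StrictMono (Real.ofDigits (b := b)) := by
  intro x y hxy
  obtain ⟨hle, i, hi⟩ := Pi.lt_def.1 hxy
  have hb : 0 < b := (x 0).pos
  refine Summable.tsum_lt_tsum (i := i) (fun j => ?_) ?_ Real.summable_ofDigitsTerm
    Real.summable_ofDigitsTerm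
  · simp only [Real.ofDigitsTerm]
    gcongr
    exact hle j
  · simp only [Real.ofDigitsTerm]
    gcongr
    exact hi

theorem eq_zero_of_ofDigits_eq_zero [NeZero b] {x : ℕ → Fin b} (hx : Real.ofDigits x = 0) :
    x = 0 := by
  by_contra hne
  have hlt := strictMono_ofDigits (lt_of_le_of_ne (fun i => Fin.zero_le (x i)) (Ne.symm hne))
  exact (hlt.trans_eq hx).not_ge (Real.ofDigits_nonneg _)

theorem eq_last_of_ofDigits_eq_one [NeZero b] {x : ℕ → Fin (b + 1)} (hx : Real.ofDigits x = 1) :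
    x = fun _ => Fin.last b := by
  by_contra hne
  have hlt := strictMono_ofDigits (lt_of_le_of_ne (fun i => Fin.le_last (x i)) hne)
  rw [hx, Real.ofDigits_const_last_eq_one] at hlt
  exact lt_irrefl _ hlt

theorem tails_of_ofDigits_eq [NeZero b] {x y : ℕ → Fin (b + 1)} {k : ℕ}
    (heq : ∀ i < k, x i = y i) (hlt : x k < y k) (h : Real.ofDigits x = Real.ofDigits y) :
    (fun n => x (n + (k + 1))) = (fun _ => Fin.last b) ∧ (fun n => y (n + (k + 1))) = 0 := by
  have hterms : ∑ i ∈ Finset.range k, Real.ofDigitsTerm x i =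
      ∑ i ∈ Finset.range k, Real.ofDigitsTerm y i :=
    Finset.sum_congr rfl fun i hi => by
      simp only [Real.ofDigitsTerm, heq i (Finset.mem_range.1 hi)]
  rw [Real.ofDigits_eq_sum_add_ofDigits x (k + 1), Real.ofDigits_eq_sum_add_ofDigits y (k + 1),
    Finset.sum_range_succ, Finset.sum_range_succ, hterms, Real.ofDigitsTerm,
    Real.ofDigitsTerm] at h
  have hscale : (((b + 1 : ℕ) : ℝ) ^ (k + 1))⁻¹ ≠ 0 := by positivity
  have hsum : ((x k : ℕ) : ℝ) + Real.ofDigits (fun i => x (i + (k + 1))) =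
      (y k : ℕ) + Real.ofDigits fun i => y (i + (k + 1)) :=
    mul_left_cancel₀ hscale (by linear_combination h)
  have hdigit : ((x k : ℕ) : ℝ) + 1 ≤ (y k : ℕ) := by exact_mod_cast hlt
  have hx1 := Real.ofDigits_le_one fun i => x (i + (k + 1))
  have hy0 := Real.ofDigits_nonneg fun i => y (i + (k + 1))
  exact ⟨eq_last_of_ofDigits_eq_one (by linarith), eq_zero_of_ofDigits_eq_zero (by linarith)⟩

theorem eventuallyConst_of_shift_eq_const {α : Type*} {x : ℕ → α} {k : ℕ} {c : α}
    (h : (fun n => x (n + k)) = fun _ => c) : EventuallyConst x atTop := by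
  have hc : ∀ j ≥ k, x j = c := fun j hj => by
    simpa only [Nat.sub_add_cancel hj] using congrFun h (j - k)
  exact eventuallyConst_atTop.2 ⟨k, fun j hj => (hc j hj).trans (hc k le_rfl).symm⟩

theorem injectiveOff_ofDigits [NeZero b] :
    InjectiveOff (Real.ofDigits (b := b + 1)) {x | EventuallyConst x atTop} := by
  intro x y h
  refine or_iff_not_imp_left.2 fun hxy => ?_
  have hex : ∃ k, x k ≠ y k := Function.ne_iff.1 hxy
  have heq : ∀ i < Nat.find hex, x i = y i := fun i hi => not_not.1 (Nat.find_min hex hi)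
  obtain hlt | hlt := (Nat.find_spec hex).lt_or_gt
  · obtain ⟨hx, hy⟩ := tails_of_ofDigits_eq heq hlt h
    exact ⟨eventuallyConst_of_shift_eq_const hx, eventuallyConst_of_shift_eq_const hy⟩
  · obtain ⟨hy, hx⟩ := tails_of_ofDigits_eq (fun i hi => (heq i hi).symm) hlt h.symm
    exact ⟨eventuallyConst_of_shift_eq_const hx, eventuallyConst_of_shift_eq_const hy⟩

end Digits

section Numbers

/-- The number in the unit interval with a given binary expansion. -/
noncomputable def toUnit (x : ℕ → Fin 2) : unitInterval :=
  ⟨Real.ofDigits x, Real.ofDigits_nonneg x, Real.ofDigits_le_one x⟩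

theorem continuous_toUnit : Continuous toUnit :=
  Real.continuous_ofDigits.subtype_mk _

theorem toUnit_surjective : Function.Surjective toUnit := by
  rintro ⟨y, hy⟩
  obtain ⟨x, -, rfl⟩ := Real.ofDigits_SurjOn one_lt_two hy
  exact ⟨x, rfl⟩

theorem injectiveOff_toUnit : InjectiveOff toUnit {x | EventuallyConst x atTop} :=
  fun _ _ h => injectiveOff_ofDigits (Subtype.ext_iff.1 h)

theorem disjoint_typicalSeq : Disjoint typicalSeq {x | EventuallyConst x atTop} :=
  Set.disjoint_left.2 fun _ => not_eventuallyConst_of_mem_typicalSeq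

theorem disjoint_normalSeq : Disjoint normalSeq {x | EventuallyConst x atTop} :=
  Set.disjoint_left.2 fun _ => not_eventuallyConst_of_mem_normalSeq

theorem tpcN_eq_image : TpcN = toUnit '' typicalSeq := by
  ext y
  simp only [TpcN, toUnit, Set.mem_ofPred_eq, Set.mem_image, Subtype.ext_iff, and_comm]

theorem normal_eq_image : Normal = toUnit '' normalSeq := by
  ext y
  simp only [Normal, toUnit, Set.mem_ofPred_eq, Set.mem_image, Subtype.ext_iff, and_comm]

theorem toUnit_preimage_tpcN : toUnit ⁻¹' TpcN = typicalSeq := by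
  rw [tpcN_eq_image, injectiveOff_toUnit.preimage_image disjoint_typicalSeq]

theorem toUnit_preimage_normal : toUnit ⁻¹' Normal = normalSeq := by
  rw [normal_eq_image, injectiveOff_toUnit.preimage_image disjoint_normalSeq]

theorem isPi0_three_toUnit_image {T : Set (ℕ → Fin 2)} (hT : IsPi0 3 T)
    (hTE : Disjoint T {x | EventuallyConst x atTop}) : IsPi0 3 (toUnit '' T) :=
  injectiveOff_toUnit.isPi0_three_image continuous_toUnit.isClosedMap toUnit_surjective
    countable_setOf_eventuallyConst hT hTE

theorem isPi0_tpcN : IsPi0 3 TpcN :=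
  tpcN_eq_image ▸ isPi0_three_toUnit_image isPi0_typicalSeq disjoint_typicalSeq

theorem isPi0_normal : IsPi0 3 Normal :=
  normal_eq_image ▸ isPi0_three_toUnit_image isPi0_normalSeq disjoint_normalSeq

end Numbers

section NormalSequencesExist

open MeasureTheory ProbabilityTheory

variable {m : ℕ}

theorem sum_range_eq_sum_residues {M : Type*} [AddCommMonoid M] (hm : 0 < m) (f : ℕ → M)
    (n : ℕ) : ∑ i ∈ Finset.range n, f i =
      ∑ r ∈ Finset.range m, ∑ j ∈ Finset.range ((n + (m - 1 - r)) / m), f (r + j * m) := by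
  rw [← Finset.sum_fiberwise_of_maps_to
    (fun i _ => Finset.mem_range.2 (Nat.mod_lt i hm) : ∀ i ∈ Finset.range n, i % m ∈ _)]
  refine Finset.sum_congr rfl fun r hr => ?_
  rw [Finset.mem_range] at hr
  have hlt (j : ℕ) : j < (n + (m - 1 - r)) / m ↔ r + j * m < n := by
    rw [← Nat.succ_le_iff, Nat.le_div_iff_mul_le hm, Nat.succ_mul]
    omega
  refine Finset.sum_nbij' (· / m) (fun j => r + j * m) ?_ ?_ ?_ ?_ ?_ <;>
    simp only [Finset.mem_filter, Finset.mem_range, hlt]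
  · rintro i ⟨hi, rfl⟩
    rwa [Nat.mod_add_div']
  · exact fun j hj => ⟨hj, by rw [Nat.add_mul_mod_self_right, Nat.mod_eq_of_lt hr]⟩
  · rintro i ⟨-, rfl⟩
    exact Nat.mod_add_div' i m
  · exact fun j _ => by rw [Nat.add_mul_div_right _ _ hm, Nat.div_eq_of_lt hr, zero_add]
  · rintro i ⟨-, rfl⟩
    rw [Nat.mod_add_div']

theorem tendsto_natCast_add_div (c : ℝ) :
    Tendsto (fun n : ℕ => ((n : ℝ) + c) / n) atTop (𝓝 1) := by
  have h := (tendsto_natCast_div_add_atTop c).inv₀ one_ne_zero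
  rw [inv_one] at h
  exact h.congr fun n => inv_div _ _

theorem tendsto_add_div_div_natCast (hm : 0 < m) (k : ℕ) :
    Tendsto (fun n : ℕ => (((n + k) / m : ℕ) : ℝ) / n) atTop (𝓝 (1 / m)) := by
  have hshift : Tendsto (fun n : ℕ => ((n + k : ℕ) : ℝ) / m) atTop atTop :=
    (tendsto_natCast_atTop_atTop.comp (tendsto_add_atTop_nat k)).atTop_div_const
      (Nat.cast_pos.2 hm)
  have hratio : Tendsto (fun n : ℕ => ((n + k : ℕ) : ℝ) / m / n) atTop (𝓝 (1 / m)) := by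
    refine ((tendsto_natCast_add_div (k : ℝ)).div_const (m : ℝ)).congr fun n => ?_
    rw [Nat.cast_add, div_right_comm]
  have h := (tendsto_nat_floor_div_atTop.comp hshift).mul hratio
  rw [one_mul] at h
  refine h.congr' ?_
  filter_upwards [hshift.eventually_ne_atTop 0] with n hn
  simp only [Function.comp_apply]
  rw [Nat.floor_div_eq_div, div_mul_div_cancel₀ hn]

theorem tendsto_average_of_residues {f : ℕ → ℝ} {c : ℝ} (hm : 0 < m)
    (hf : ∀ r < m, Tendsto (fun N : ℕ => (∑ j ∈ Finset.range N, f (r + j * m)) / N) atTop (𝓝 c)) :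
    Tendsto (fun n : ℕ => (∑ i ∈ Finset.range n, f i) / n) atTop (𝓝 c) := by
  have hterm (r : ℕ) (hr : r ∈ Finset.range m) : Tendsto (fun n : ℕ =>
      (∑ j ∈ Finset.range ((n + (m - 1 - r)) / m), f (r + j * m)) / n) atTop (𝓝 (c * (1 / m))) := by
    have hquot : Tendsto (fun n => (n + (m - 1 - r)) / m) atTop atTop :=
      (Nat.tendsto_div_const_atTop hm.ne').comp (tendsto_add_atTop_nat _)
    refine (((hf r (Finset.mem_range.1 hr)).comp hquot).mul
      (tendsto_add_div_div_natCast hm (m - 1 - r))).congr' ?_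
    filter_upwards [hquot.eventually_ne_atTop 0] with n hn
    exact div_mul_div_cancel₀ (Nat.cast_ne_zero.2 hn)
  have hsum := tendsto_finsetSum (Finset.range m) hterm
  rw [Finset.sum_const, Finset.card_range, nsmul_eq_mul, mul_one_div,
    mul_div_cancel₀ _ (Nat.cast_ne_zero.2 hm.ne')] at hsum
  refine hsum.congr fun n => ?_
  rw [sum_range_eq_sum_residues hm f, Finset.sum_div]

variable {Ω : Type*} [MeasurableSpace Ω] (μ : Measure Ω) [IsProbabilityMeasure μ]

theorem iIndepFun_eval_infinitePi :
    iIndepFun (fun (i : ℕ) (x : ℕ → Ω) => x i) (Measure.infinitePi fun _ => μ) :=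
  iIndepFun_infinitePi (X := fun _ => id) fun _ => measurable_id

theorem measurePreserving_window (m s : ℕ) :
    MeasurePreserving (fun (x : ℕ → Ω) (k : Fin m) => x (s + k))
      (Measure.infinitePi fun _ => μ) (Measure.pi fun _ => μ) := by
  refine ⟨by fun_prop, ?_⟩
  have h := ((iIndepFun_eval_infinitePi μ).precomp (g := fun k : Fin m => s + (k : ℕ))
    ((add_right_injective s).comp Fin.val_injective)).map_fun_eq_pi_map fun k =>
      (measurable_pi_apply _).aemeasurable
  simpa only [Measure.infinitePi_map_eval] using h

theorem indepFun_window {s t : ℕ} (hst : s + m ≤ t) :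
    IndepFun (fun (x : ℕ → Ω) (k : Fin m) => x (s + k)) (fun x (k : Fin m) => x (t + k))
      (Measure.infinitePi fun _ => μ) := by
  have hdisj : Disjoint (Finset.Ico s (s + m)) (Finset.Ico t (t + m)) :=
    Finset.Ico_disjoint_Ico_consecutive s (s + m) (t + m) |>.mono_right
      (Finset.Ico_subset_Ico_left hst)
  let restrict (s : ℕ) (u : Finset.Ico s (s + m) → Ω) (k : Fin m) : Ω := u ⟨s + k, by simp⟩
  have hrestrict (s : ℕ) : Measurable (restrict s) :=
    measurable_pi_lambda _ fun k => measurable_pi_apply _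
  exact ((iIndepFun_eval_infinitePi μ).indepFun_finset _ _ hdisj measurable_pi_apply).comp
    (hrestrict s) (hrestrict t)

theorem ae_tendsto_average_window {g : (Fin m → Ω) → ℝ}
    (hg : Integrable g (Measure.pi fun _ => μ)) :
    ∀ᵐ x ∂Measure.infinitePi fun _ : ℕ => μ,
      Tendsto (fun n : ℕ => (∑ i ∈ Finset.range n, g fun k => x (i + k)) / n) atTop
        (𝓝 (∫ u, g u ∂Measure.pi fun _ => μ)) := by
  let Y (i : ℕ) (x : ℕ → Ω) : ℝ := g fun k => x (i + k)
  have hwindow := measurePreserving_window μ m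
  have hgmap (i : ℕ) : AEMeasurable g ((Measure.infinitePi fun _ => μ).map
      fun (x : ℕ → Ω) (k : Fin m) => x (i + k)) := (hwindow i).map_eq ▸ hg.aemeasurable
  have hident (i j : ℕ) : IdentDistrib (Y i) (Y j) (Measure.infinitePi fun _ => μ)
      (Measure.infinitePi fun _ => μ) := by
    refine .comp_of_aemeasurable ⟨(hwindow i).aemeasurable, (hwindow j).aemeasurable, ?_⟩
      (hgmap i)
    rw [(hwindow i).map_eq, (hwindow j).map_eq]
  have hint (i : ℕ) : ∫ x, Y i x ∂Measure.infinitePi (fun _ => μ) =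
      ∫ u, g u ∂Measure.pi fun _ => μ := by
    rw [← (hwindow i).map_eq]
    refine (integral_map (hwindow i).aemeasurable ?_).symm
    rw [(hwindow i).map_eq]
    exact hg.aestronglyMeasurable
  have hindep {i j : ℕ} (hij : i + m ≤ j) :
      IndepFun (Y i) (Y j) (Measure.infinitePi fun _ => μ) :=
    (indepFun_window μ hij).comp₀ (hwindow i).aemeasurable (hwindow j).aemeasurable
      (hgmap i) (hgmap j)
  have hspaced {r i j : ℕ} (hij : i < j) : r + i * (m + 1) + m ≤ r + j * (m + 1) := by
    have := Nat.mul_le_mul_right (m + 1) (Nat.succ_le_of_lt hij)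
    rw [Nat.succ_mul] at this
    omega
  have hresidue (r : ℕ) := strong_law_ae_real (fun j => Y (r + j * (m + 1)))
    ((hwindow _).integrable_comp_of_integrable hg)
    (fun i j hij => hij.lt_or_gt.elim (fun h => hindep (hspaced h))
      fun h => (hindep (hspaced h)).symm) fun i => hident _ _
  filter_upwards [ae_all_iff.2 hresidue] with x hx
  exact tendsto_average_of_residues m.succ_pos fun r _ => hint _ ▸ hx r

theorem tendsto_blockCount_div_of_tendsto_count {x : ℕ → Fin 2} {w : Fin m → Fin 2} {c : ℝ}
    (h : Tendsto (fun n : ℕ => (Nat.count (fun i => ∀ k : Fin m, x (i + k) = w k) n : ℝ) / n)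
      atTop (𝓝 c)) :
    Tendsto (fun n : ℕ => (blockCount x w n : ℝ) / n) atTop (𝓝 c) := by
  have hshift : Tendsto (fun n => n + 1 - m) atTop atTop :=
    (tendsto_sub_atTop_nat m).comp (tendsto_add_atTop_nat 1)
  have hratio : Tendsto (fun n : ℕ => ((n + 1 - m : ℕ) : ℝ) / n) atTop (𝓝 1) := by
    have h : Tendsto (fun n : ℕ => 1 + (1 - m : ℝ) / n) atTop (𝓝 (1 + 0)) :=
      tendsto_const_nhds.add (tendsto_const_nhds.div_atTop tendsto_natCast_atTop_atTop)
    rw [add_zero] at h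
    refine h.congr' ?_
    filter_upwards [eventually_gt_atTop 0, eventually_ge_atTop m] with n hn hmn
    rw [Nat.cast_sub (by omega), one_add_div (Nat.cast_ne_zero.2 hn.ne'), Nat.cast_add_one,
      add_sub_assoc]
  have hmul := (h.comp hshift).mul hratio
  rw [mul_one] at hmul
  refine hmul.congr' ?_
  filter_upwards [hshift.eventually_ne_atTop 0] with n hn
  rw [blockCount_eq_count]
  exact div_mul_div_cancel₀ (Nat.cast_ne_zero.2 hn)

theorem ae_mem_normalSeq :
    ∀ᵐ x ∂Measure.infinitePi fun _ : ℕ => (PMF.uniformOfFintype (Fin 2)).toMeasure,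
      x ∈ normalSeq := by
  refine ae_all_iff.2 fun m => ae_all_iff.2 fun w => ?_
  have hprob : ∫ u, Set.indicator {w} 1 u
      ∂Measure.pi (fun _ => (PMF.uniformOfFintype (Fin 2)).toMeasure) = (1 : ℝ) / 2 ^ m := by
    rw [integral_indicator_one (measurableSet_singleton w), measureReal_def, Measure.pi_singleton]
    simp
  filter_upwards [ae_tendsto_average_window _ (Integrable.of_finite (f := Set.indicator {w} 1))]
    with x hx
  rw [hprob] at hx
  refine tendsto_blockCount_div_of_tendsto_count (hx.congr fun n => ?_)
  simp only [Set.indicator_apply, Set.mem_singleton_iff, funext_iff, Pi.one_apply,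
    Finset.sum_boole, Nat.count_eq_card_filter_range]

theorem nonempty_normalSeq : normalSeq.Nonempty :=
  ae_mem_normalSeq.exists

end NormalSequencesExist

section Density

variable {x y : ℕ → Fin 2} {m : ℕ}

theorem blockCount_le_add_count_ne (x y : ℕ → Fin 2) (w : Fin m → Fin 2) (n : ℕ) :
    blockCount x w n ≤ blockCount y w n + m * Nat.count (fun i => x i ≠ y i) n := by
  let changed := (Finset.range n).filter fun i => x i ≠ y i
  let affected := Finset.image₂ (fun (k : Fin m) i => i - (k : ℕ)) Finset.univ changed
  have hsub : (Finset.range (n + 1)).filter (fun i => i + m ≤ n ∧ ∀ k : Fin m, x (i + k) = w k) ⊆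
      (Finset.range (n + 1)).filter (fun i => i + m ≤ n ∧ ∀ k : Fin m, y (i + k) = w k) ∪
        affected := fun i hi => by
    simp only [Finset.mem_filter, Finset.mem_range, Finset.mem_union] at hi ⊢
    by_cases hy : ∀ k : Fin m, y (i + k) = w k
    · exact .inl ⟨hi.1, hi.2.1, hy⟩
    push Not at hy
    obtain ⟨k, hk⟩ := hy
    refine .inr (Finset.mem_image₂.2 ⟨k, Finset.mem_univ k, i + k, ?_, Nat.add_sub_cancel _ _⟩)
    rw [Finset.mem_filter, Finset.mem_range, hi.2.2 k]
    exact ⟨by omega, hk.symm⟩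
  calc blockCount x w n ≤ blockCount y w n + affected.card :=
        (Finset.card_le_card hsub).trans (Finset.card_union_le _ _)
    _ ≤ blockCount y w n + m * Nat.count (fun i => x i ≠ y i) n := by
        rw [Nat.count_eq_card_filter_range]
        gcongr
        exact (Finset.card_image₂_le _ _ _).trans (by rw [Finset.card_fin])

theorem mem_normalSeq_of_tendsto_count_ne (hx : x ∈ normalSeq)
    (h : Tendsto (fun n : ℕ => (Nat.count (fun i => x i ≠ y i) n : ℝ) / n) atTop (𝓝 0)) :
    y ∈ normalSeq := by
  intro m w
  refine (hx m w).congr_dist ?_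
  have hm := h.const_mul (m : ℝ)
  rw [mul_zero] at hm
  refine squeeze_zero (fun _ => dist_nonneg) (fun n => ?_) hm
  have hxy : (blockCount x w n : ℝ) ≤
      blockCount y w n + m * Nat.count (fun i => x i ≠ y i) n := by
    exact_mod_cast blockCount_le_add_count_ne x y w n
  have hyx : (blockCount y w n : ℝ) ≤
      blockCount x w n + m * Nat.count (fun i => x i ≠ y i) n := by
    simp_rw [ne_comm (a := x _)]
    exact_mod_cast blockCount_le_add_count_ne y x w n
  rw [Real.dist_eq, ← sub_div, abs_div, Nat.abs_cast, ← mul_div_assoc]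
  gcongr
  exact abs_le.2 ⟨by linarith, by linarith⟩

theorem tendsto_natLog_two_atTop : Tendsto (Nat.log 2) atTop atTop :=
  tendsto_atTop_atTop_of_monotone Nat.log_monotone fun n =>
    ⟨2 ^ n, (Nat.log_pow one_lt_two n).ge⟩

theorem count_two_pow (p : ℕ → Prop) [DecidablePred p] (M : ℕ) :
    Nat.count p (2 ^ M) =
      Nat.count p 1 + ∑ n ∈ Finset.range M, Nat.count (fun r => p (2 ^ n + r)) (2 ^ n) := by
  induction M with
  | zero => simp
  | succ M ih => rw [pow_succ, mul_two, Nat.count_add, ih, Finset.sum_range_succ, add_assoc]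

theorem tendsto_linear_div_two_pow (c d : ℝ) :
    Tendsto (fun n : ℕ => (c * n + d) / 2 ^ n) atTop (𝓝 0) := by
  have hlin := (tendsto_pow_const_div_const_pow_of_one_lt 1 (one_lt_two (α := ℝ))).const_mul c
  have hconst := (tendsto_pow_const_div_const_pow_of_one_lt 0 (one_lt_two (α := ℝ))).const_mul d
  have h := hlin.add hconst
  rw [mul_zero, mul_zero, add_zero] at h
  refine h.congr fun n => ?_
  rw [pow_one, pow_zero]
  ring

theorem tendsto_sum_range_div_two_pow {D : ℕ → ℝ}
    (hD : Tendsto (fun n => D n / 2 ^ n) atTop (𝓝 0)) :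
    Tendsto (fun M => (∑ n ∈ Finset.range M, D n) / 2 ^ M) atTop (𝓝 0) := by
  have hgeom (M : ℕ) : ∑ n ∈ Finset.range M, (2 : ℝ) ^ n = 2 ^ M - 1 := by
    rw [geom_sum_eq (by norm_num)]
    norm_num
  have hD' : D =o[atTop] fun n => (2 : ℝ) ^ n :=
    (Asymptotics.isLittleO_iff_tendsto fun n hn => absurd hn (by positivity)).2 hD
  have hsum := hD'.sum_range (fun n => pow_nonneg zero_le_two n) (by
    simp_rw [hgeom]
    exact tendsto_atTop_add_const_right _ _ (tendsto_pow_atTop_atTop_of_one_lt one_lt_two))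
  simp_rw [hgeom] at hsum
  refine (hsum.trans_isBigO (.of_bound 1 (.of_forall fun M => ?_))).tendsto_div_nhds_zero
  have hM : (1 : ℝ) ≤ 2 ^ M := one_le_pow₀ one_le_two
  rw [Real.norm_of_nonneg (by linarith), Real.norm_of_nonneg (by linarith)]
  linarith

theorem tendsto_count_div_of_dyadic {p : ℕ → Prop} [DecidablePred p]
    (hp : Tendsto (fun n : ℕ => (Nat.count (fun r => p (2 ^ n + r)) (2 ^ n) : ℝ) / 2 ^ n) atTop
      (𝓝 0)) :
    Tendsto (fun N : ℕ => (Nat.count p N : ℝ) / N) atTop (𝓝 0) := by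
  have hpow : Tendsto (fun M : ℕ => (Nat.count p (2 ^ M) : ℝ) / 2 ^ M) atTop (𝓝 0) := by
    have h := (tendsto_linear_div_two_pow 0 (Nat.count p 1)).add (tendsto_sum_range_div_two_pow hp)
    rw [add_zero] at h
    refine h.congr fun M => ?_
    rw [count_two_pow, ← add_div, zero_mul, zero_add, Nat.cast_add, Nat.cast_sum]
  have hlog : Tendsto (fun N => Nat.log 2 N + 1) atTop atTop :=
    (tendsto_add_atTop_nat 1).comp tendsto_natLog_two_atTop
  have h := (hpow.comp hlog).const_mul 2
  rw [mul_zero] at h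
  refine squeeze_zero' (.of_forall fun N => by positivity) ?_ h
  filter_upwards [eventually_ne_atTop 0] with N hN
  have hle : (2 : ℝ) ^ Nat.log 2 N ≤ N := by exact_mod_cast Nat.pow_log_le_self 2 hN
  have hlt : N ≤ 2 ^ (Nat.log 2 N + 1) := (Nat.lt_pow_succ_log_self one_lt_two N).le
  calc (Nat.count p N : ℝ) / N
      ≤ Nat.count p (2 ^ (Nat.log 2 N + 1)) / 2 ^ Nat.log 2 N := by
        gcongr
    _ = 2 * (Nat.count p (2 ^ (Nat.log 2 N + 1)) / 2 ^ (Nat.log 2 N + 1)) := by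
        rw [pow_succ (2 : ℝ)]
        field_simp

theorem tendsto_natDiv_div_iff {u q : ℕ → ℕ} (hu : Tendsto u atTop atTop) :
    Tendsto (fun n => ((u n / (q n + 1) : ℕ) : ℝ) / u n) atTop (𝓝 0) ↔ Tendsto q atTop atTop := by
  have hu' : Tendsto (fun n => (u n : ℝ)) atTop atTop := tendsto_natCast_atTop_atTop.comp hu
  have hdist : Tendsto (fun n => dist (((u n / (q n + 1) : ℕ) : ℝ) / u n) ((q n + 1 : ℝ)⁻¹))
      atTop (𝓝 0) := by
    refine squeeze_zero' (.of_forall fun _ => dist_nonneg) ?_ hu'.inv_tendsto_atTop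
    filter_upwards [hu'.eventually_gt_atTop 0] with n hn
    have hlower : (u n : ℝ) / (q n + 1) < (u n / (q n + 1) : ℕ) + 1 := by
      rw [div_lt_iff₀ (by positivity)]
      exact_mod_cast Nat.lt_mul_of_div_lt (Nat.lt_succ_self _) (Nat.succ_pos _)
    have hupper : ((u n / (q n + 1) : ℕ) : ℝ) ≤ u n / (q n + 1) := by
      simpa using Nat.cast_div_le (α := ℝ) (m := u n) (n := q n + 1)
    have heq : (q n + 1 : ℝ)⁻¹ = u n / (q n + 1) / u n := by field_simp
    rw [Real.dist_eq, heq, ← sub_div, abs_div, abs_of_pos hn, div_eq_mul_inv, Pi.inv_apply]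
    refine mul_le_of_le_one_left (by positivity) (abs_le.2 ⟨by linarith, by linarith⟩)
  rw [tendsto_iff_of_dist hdist, ← tendsto_natCast_atTop_iff (R := ℝ)]
  constructor
  · intro h
    have hinv := tendsto_inv_nhdsGT_zero.comp
      (tendsto_nhdsWithin_iff.2 ⟨h, .of_forall fun n => inv_pos.2 (Nat.cast_add_one_pos (q n))⟩)
    refine tendsto_atTop_add_const_right _ (-1) hinv |>.congr fun n => ?_
    simp
  · intro h
    exact (tendsto_atTop_add_const_right _ 1 h).inv_tendsto_atTop

theorem tendsto_gap_div_of_tendsto_average {S E : ℕ → ℝ} {N Z : ℕ → ℕ} {c : ℝ} (hc : 0 < c)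
    (hS : Tendsto (fun n : ℕ => S n / n) atTop (𝓝 c)) (hN : Tendsto N atTop atTop)
    (hE : Tendsto (fun k => E k / N k) atTop (𝓝 0)) (hZ : ∀ k, Z k ≤ N k)
    (hgap : ∀ k, S (N k + Z k) ≤ S (N k) + E k) :
    Tendsto (fun k => (Z k : ℝ) / N k) atTop (𝓝 0) := by
  have herr {M : ℕ → ℕ} (hM : Tendsto M atTop atTop) :
      Tendsto (fun k => |S (M k) / M k - c|) atTop (𝓝 0) :=
    (tendsto_iff_dist_tendsto_zero.1 hS).comp hM
  have hNZ : Tendsto (fun k => N k + Z k) atTop atTop :=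
    tendsto_atTop_mono (fun k => Nat.le_add_right _ _) hN
  have h := ((hE.add (herr hN)).add ((herr hNZ).const_mul 2)).div_const c
  rw [mul_zero, add_zero, add_zero, zero_div] at h
  refine squeeze_zero' (.of_forall fun k => by positivity) ?_ h
  filter_upwards [hN.eventually_gt_atTop 0] with k hk
  have hNpos : (0 : ℝ) < N k := Nat.cast_pos.2 hk
  have hZN : (Z k : ℝ) ≤ N k := Nat.cast_le.2 (hZ k)
  have hmul {M : ℕ} (hM : (0 : ℝ) < M) : |S M - c * M| = |S M / M - c| * M := by
    rw [div_sub' hM.ne', abs_div, abs_of_pos hM, div_mul_cancel₀ _ hM.ne', mul_comm]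
  have hstart := (le_abs_self _).trans_eq (hmul hNpos)
  have hend := (neg_le_abs _).trans_eq (hmul (M := N k + Z k) (by positivity))
  push_cast at hend
  have hslack : |S (N k + Z k) / ((N k : ℝ) + Z k) - c| * (N k + Z k) ≤
      |S (N k + Z k) / ((N k : ℝ) + Z k) - c| * (2 * N k) := by
    gcongr
    linarith
  -- `c Z = c (N + Z) - c N`, where `c (N + Z)` and `c N` differ from the values of `S` by `o(N)`.
  rw [le_div_iff₀ hc, div_mul_eq_mul_div, div_le_iff₀ hNpos, add_mul, add_mul,
    div_mul_cancel₀ _ hNpos.ne', Nat.cast_add]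
  linarith [hgap k]

end Density

section DyadicRuns

variable {x : ℕ → Fin 2}

theorem runLength_mono (x : ℕ → Fin 2) : Monotone fun n => runLength n x := fun _ _ h =>
  runLength_le fun _ _ hij hx => le_runLength (hij.trans h) hx

theorem tendsto_two_pow_atTop : Tendsto (fun n => 2 ^ n : ℕ → ℕ) atTop atTop :=
  tendsto_pow_atTop_atTop_of_one_lt one_lt_two

theorem mem_typicalSeq_iff_two_pow :
    x ∈ typicalSeq ↔ Tendsto (fun n : ℕ => (runLength (2 ^ n) x : ℝ) / n) atTop (𝓝 1) := by
  constructor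
  · intro h
    refine (Tendsto.comp h tendsto_two_pow_atTop).congr fun n => ?_
    simp only [Function.comp_apply]
    rw [Nat.cast_pow, Nat.cast_ofNat, Real.logb_pow, Real.logb_self_eq_one one_lt_two, mul_one]
  intro h
  have hlower := (h.mul (tendsto_natCast_div_add_atTop (1 : ℝ))).comp tendsto_natLog_two_atTop
  have hupper := ((h.comp (tendsto_add_atTop_nat 1)).mul (tendsto_natCast_add_div 1)).comp
    tendsto_natLog_two_atTop
  rw [mul_one] at hlower hupper
  refine tendsto_of_tendsto_of_tendsto_of_le_of_le' hlower hupper ?_ ?_ <;>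
  filter_upwards [eventually_ge_atTop 2] with N hN <;>
  have hL : (0 : ℝ) < Nat.log 2 N := Nat.cast_pos.2 (Nat.log_pos one_lt_two hN) <;>
  have hfloor : (Nat.log 2 N : ℝ) ≤ Real.logb 2 N := Real.natLog_le_logb N 2 <;>
  simp only [Function.comp_apply]
  · have hceil : Real.logb 2 N ≤ Nat.log 2 N + 1 := by
      have hlt : (N : ℝ) < 2 ^ (Nat.log 2 N + 1) := by
        exact_mod_cast Nat.lt_pow_succ_log_self one_lt_two N
      rw [Real.logb_le_iff_le_rpow one_lt_two (by positivity)]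
      exact_mod_cast hlt.le
    rw [div_mul_div_cancel₀ hL.ne']
    gcongr
    · exact hL.trans_le hfloor
    · exact runLength_mono x (Nat.pow_log_le_self 2 (by omega))
  · rw [Nat.cast_add_one, div_mul_div_cancel₀ (by positivity)]
    gcongr
    exact runLength_mono x (Nat.lt_pow_succ_log_self one_lt_two N).le

theorem eventually_forall_lt_natCast_le {u : ℕ → ℝ} {c : ℝ} (hc : 0 < c)
    (hu : ∀ᶠ k : ℕ in atTop, u k ≤ c * k) : ∀ᶠ n : ℕ in atTop, ∀ k < n, u k ≤ c * n := by
  obtain ⟨n₀, hn₀⟩ := eventually_atTop.1 hu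
  have hsmall : ∀ᶠ n : ℕ in atTop, ∀ k ∈ Set.Iio n₀, u k ≤ c * n :=
    (eventually_all_finite (Set.finite_Iio n₀)).2 fun k _ =>
      (tendsto_natCast_atTop_atTop.const_mul_atTop hc).eventually_ge_atTop (u k)
  filter_upwards [hsmall] with n hn k hk
  rcases lt_or_ge k n₀ with h | h
  · exact hn k h
  · exact (hn₀ k h).trans (by gcongr)

theorem runLength_two_pow_le {R : ℕ → ℕ} {B n : ℕ} (hn : n ≠ 0)
    (hzero : ∀ i, ∃ k ≤ R (Nat.log 2 i), x (i + k) = 0) (hB : ∀ k < n, R k ≤ B) :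
    runLength (2 ^ n) x ≤ B := by
  refine runLength_le fun i j hij hj => ?_
  rcases Nat.eq_zero_or_pos j with rfl | hj0
  · exact B.zero_le
  obtain ⟨k, hk, hk0⟩ := hzero i
  have hjk : j ≤ k := by
    by_contra! hlt
    have := hj k hlt
    omega
  exact hjk.trans (hk.trans (hB _ (Nat.log_lt_of_lt_pow' hn (by omega))))

theorem mem_typicalSeq_iff_of_dyadic_runs {R : ℕ → ℕ} (hR : ∀ n, n ≤ R n)
    (hzero : ∀ i, ∃ k ≤ R (Nat.log 2 i), x (i + k) = 0)
    (hrun : ∀ᶠ n in atTop, R n ≤ runLength (2 ^ (n + 1)) x) :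
    x ∈ typicalSeq ↔ Tendsto (fun n : ℕ => (R n : ℝ) / n) atTop (𝓝 1) := by
  rw [mem_typicalSeq_iff_two_pow]
  constructor
  · intro h
    have hupper := (h.comp (tendsto_add_atTop_nat 1)).mul (tendsto_natCast_add_div 1)
    rw [mul_one] at hupper
    refine tendsto_of_tendsto_of_tendsto_of_le_of_le' tendsto_const_nhds hupper ?_ ?_
    · filter_upwards [eventually_gt_atTop 0] with n hn
      rw [one_le_div (Nat.cast_pos.2 hn)]
      exact_mod_cast hR n
    · filter_upwards [hrun] with n hn
      simp only [Function.comp_apply]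
      rw [Nat.cast_add_one, div_mul_div_cancel₀ (by positivity)]
      gcongr
  · intro h
    refine tendsto_order.2 ⟨fun c hc => ?_, fun c hc => ?_⟩
    · have hlower := tendsto_natCast_div_add_atTop (1 : ℝ)
      rw [← map_add_atTop_eq_nat 1, eventually_map]
      filter_upwards [hlower.eventually_const_lt hc, hrun] with n hn hRn
      refine hn.trans_le ?_
      rw [Nat.cast_add_one]
      gcongr
      exact (hR n).trans hRn
    · obtain ⟨c', hc', hcc'⟩ := exists_between hc
      have hle : ∀ᶠ k : ℕ in atTop, (R k : ℝ) ≤ c' * k := by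
        filter_upwards [h.eventually_le_const hc', eventually_gt_atTop 0] with k hk hk0
        exact (div_le_iff₀ (Nat.cast_pos.2 hk0)).1 hk
      filter_upwards [eventually_forall_lt_natCast_le (zero_lt_one.trans hc') hle,
        eventually_ne_atTop 0] with n hn hn0
      have hn0' : (0 : ℝ) < n := Nat.cast_pos.2 (Nat.pos_of_ne_zero hn0)
      refine ((div_le_iff₀ hn0').2 ?_).trans_lt hcc'
      have hfloor := runLength_two_pow_le hn0 hzero fun k hk => Nat.le_floor (hn k hk)
      exact (Nat.le_floor_iff (by positivity)).1 hfloor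

end DyadicRuns

section Encoding

/-- The length of the run of ones planted in the dyadic stage `[2 ^ n, 2 ^ (n + 1))`. -/
def plantedRun (a : ℕ → ℕ) (n : ℕ) : ℕ := n + n / (a (2 * n + 1) + 1)

/-- The digit which `encode` puts at position `2 ^ n + r`, for `r < 2 ^ n`, where the base sequence
has the digit `d`. A run of ones of length `plantedRun a n` between two zeros is followed by zeros
up to a proportion of `1 / (a (2 * n) + 1)` of the stage, and from then on by the digits of the base
sequence, with zeros at the multiples of `n + 1` to keep their runs of ones shorter than the planted
one. -/
def stageDigit (a : ℕ → ℕ) (n r : ℕ) (d : Fin 2) : Fin 2 :=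
  if r < plantedRun a n + 2 then (if r = 0 ∨ r = plantedRun a n + 1 then 0 else 1)
  else if r * (a (2 * n) + 1) < 2 ^ n ∨ n + 1 ∣ r then 0 else d

/-- The modification of the base sequence `b` whose runs of ones record the odd-indexed terms of `a`
and whose density of ones records the even-indexed terms. -/
def encode (b : ℕ → Fin 2) (a : ℕ → ℕ) (i : ℕ) : Fin 2 :=
  stageDigit a (Nat.log 2 i) (i - 2 ^ Nat.log 2 i) (b i)

variable {b : ℕ → Fin 2} {a : ℕ → ℕ} {n : ℕ}

theorem continuous_encode (b : ℕ → Fin 2) : Continuous (encode b) := by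
  refine continuous_pi fun i => ?_
  refine continuous_of_dependsOn_finite (s := {2 * Nat.log 2 i, 2 * Nat.log 2 i + 1})
    (fun a a' h => ?_) (Set.toFinite _)
  have heven := h (2 * Nat.log 2 i) (by simp)
  have hodd := h (2 * Nat.log 2 i + 1) (by simp)
  rw [encode, encode, stageDigit, stageDigit, plantedRun, plantedRun, heven, hodd]

theorem plantedRun_le (a : ℕ → ℕ) (n : ℕ) : plantedRun a n ≤ 2 * n := by
  have := Nat.div_le_self n (a (2 * n + 1) + 1)
  unfold plantedRun
  omega

theorem exists_stageDigit_eq_zero (a : ℕ → ℕ) (n r : ℕ) :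
    ∃ k ≤ plantedRun a n, ∀ d, stageDigit a n (r + k) d = 0 := by
  rcases Nat.eq_zero_or_pos r with rfl | hr
  · exact ⟨0, Nat.zero_le _, fun d => by simp [stageDigit]⟩
  rcases lt_or_ge r (plantedRun a n + 2) with hrun | hrun
  · refine ⟨plantedRun a n + 1 - r, by omega, fun d => ?_⟩
    rw [Nat.add_sub_of_le (by omega)]
    simp [stageDigit]
  · have hn : n ≤ plantedRun a n := Nat.le_add_right _ _
    have hmod : (r + n) % (n + 1) < n + 1 := Nat.mod_lt _ n.succ_pos
    have hdvd : n + 1 ∣ r + (n - (r + n) % (n + 1)) := by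
      rw [← Nat.add_sub_assoc (by omega)]
      exact Nat.dvd_sub_mod _
    exact ⟨n - (r + n) % (n + 1), by omega, fun d => by
      rw [stageDigit, if_neg (by omega), if_pos (.inr hdvd)]⟩

theorem encode_two_pow_add {r : ℕ} (hr : r < 2 ^ n) :
    encode b a (2 ^ n + r) = stageDigit a n r (b (2 ^ n + r)) := by
  have : Nat.log 2 (2 ^ n + r) = n :=
    Nat.log_eq_of_pow_le_of_lt_pow (Nat.le_add_right _ _) (by rw [pow_succ]; omega)
  rw [encode, this, Nat.add_sub_cancel_left]

theorem encode_two_pow (n : ℕ) : encode b a (2 ^ n) = 0 := by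
  simpa [stageDigit] using encode_two_pow_add (b := b) (a := a) (Nat.two_pow_pos n)

theorem exists_encode_eq_zero (b : ℕ → Fin 2) (a : ℕ → ℕ) (i : ℕ) :
    ∃ k ≤ plantedRun a (Nat.log 2 i), encode b a (i + k) = 0 := by
  rcases Nat.eq_zero_or_pos i with rfl | hi
  · exact ⟨0, Nat.zero_le _, by simp [encode, stageDigit]⟩
  obtain ⟨r, hir⟩ := Nat.exists_eq_add_of_le (Nat.pow_log_le_self 2 hi.ne')
  have hend := Nat.lt_pow_succ_log_self one_lt_two i
  rw [pow_succ] at hend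
  generalize Nat.log 2 i = n at *
  subst hir
  obtain ⟨k, hk, hzero⟩ := exists_stageDigit_eq_zero a n r
  rcases lt_or_ge (r + k) (2 ^ n) with hstage | hstage
  · exact ⟨k, hk, by rw [add_assoc, encode_two_pow_add hstage, hzero]⟩
  · refine ⟨2 ^ n - r, by omega, ?_⟩
    rw [show 2 ^ n + r + (2 ^ n - r) = 2 ^ (n + 1) by rw [pow_succ]; omega, encode_two_pow]

theorem plantedRun_le_runLength (hn : plantedRun a n + 1 ≤ 2 ^ n) :
    plantedRun a n ≤ runLength (2 ^ (n + 1)) (encode b a) := by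
  refine le_runLength (i := 2 ^ n + 1) (by rw [pow_succ]; omega) fun k hk => ?_
  rw [add_assoc, encode_two_pow_add (by omega), stageDigit, if_pos (by omega), if_neg (by omega)]

theorem tendsto_plantedRun_div_iff :
    Tendsto (fun n : ℕ => (plantedRun a n : ℝ) / n) atTop (𝓝 1) ↔ a ∈ oddDivergent := by
  have hsplit : (fun n : ℕ => (plantedRun a n : ℝ) / n) =ᶠ[atTop]
      fun n => 1 + ((n / (a (2 * n + 1) + 1) : ℕ) : ℝ) / n := by
    filter_upwards [eventually_ne_atTop 0] with n hn
    rw [plantedRun, Nat.cast_add, add_div, div_self (Nat.cast_ne_zero.2 hn)]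
  rw [tendsto_congr' hsplit]
  refine Iff.trans ⟨fun h => ?_, fun h => ?_⟩ (tendsto_natDiv_div_iff tendsto_id)
  · simpa using h.sub_const 1
  · simpa using h.const_add 1

theorem encode_mem_typicalSeq_iff : encode b a ∈ typicalSeq ↔ a ∈ oddDivergent := by
  refine (mem_typicalSeq_iff_of_dyadic_runs (fun n => Nat.le_add_right _ _)
    (exists_encode_eq_zero b a) ?_).trans tendsto_plantedRun_div_iff
  have hsmall := (tendsto_linear_div_two_pow 2 1).eventually_le_const one_pos
  filter_upwards [hsmall] with n hn
  rw [div_le_one (by positivity)] at hn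
  have hn' : 2 * n + 1 ≤ 2 ^ n := by exact_mod_cast hn
  exact plantedRun_le_runLength ((Nat.succ_le_succ (plantedRun_le a n)).trans hn')

theorem count_ne_encode_le (b : ℕ → Fin 2) (a : ℕ → ℕ) (n : ℕ) :
    Nat.count (fun r => b (2 ^ n + r) ≠ encode b a (2 ^ n + r)) (2 ^ n) ≤
      (2 * n + 2) + (2 ^ n / (a (2 * n) + 1) + 1) + (2 ^ n / (n + 1) + 1) := by
  rw [Nat.count_eq_card_filter_range]
  calc _ ≤ ((Finset.range (2 * n + 2) ∪ Finset.range (2 ^ n / (a (2 * n) + 1) + 1)) ∪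
        (Finset.range (2 ^ n / (n + 1) + 1)).image (· * (n + 1))).card := by
        refine Finset.card_le_card fun r hr => ?_
        rw [Finset.mem_filter, Finset.mem_range] at hr
        obtain ⟨hr, hne⟩ := hr
        rw [encode_two_pow_add hr, stageDigit] at hne
        have hrun := plantedRun_le a n
        simp only [Finset.mem_union, Finset.mem_range, Finset.mem_image]
        split_ifs at hne with hplanted hends hzero
        · omega
        · omega
        · refine hzero.imp (fun hpad => ?_) fun ⟨q, hq⟩ => ⟨q, ?_, hq ▸ mul_comm _ _⟩
          · exact .inr (Nat.lt_succ_of_le ((Nat.le_div_iff_mul_le (Nat.succ_pos _)).2 hpad.le))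
          · rw [Nat.lt_succ_iff, Nat.le_div_iff_mul_le (Nat.succ_pos _), mul_comm, ← hq]
            exact hr.le
        · exact absurd rfl hne
    _ ≤ _ := by
      refine (Finset.card_union_le _ _).trans (Nat.add_le_add ?_ ?_)
      · exact (Finset.card_union_le _ _).trans (by simp)
      · exact Finset.card_image_le.trans (by simp)

theorem encode_mem_normalSeq (hb : b ∈ normalSeq) (ha : a ∈ evenDivergent) :
    encode b a ∈ normalSeq := by
  refine mem_normalSeq_of_tendsto_count_ne hb (tendsto_count_div_of_dyadic ?_)
  have hpad := (tendsto_natDiv_div_iff tendsto_two_pow_atTop).2 ha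
  have hmult := (tendsto_natDiv_div_iff tendsto_two_pow_atTop).2 tendsto_id
  have h := ((tendsto_linear_div_two_pow 2 4).add hpad).add hmult
  rw [add_zero, add_zero] at h
  refine squeeze_zero (fun n => by positivity) (fun n => ?_) h
  have hcount : (Nat.count (fun r => b (2 ^ n + r) ≠ encode b a (2 ^ n + r)) (2 ^ n) : ℝ) ≤
      (2 * n + 2) + ((2 ^ n / (a (2 * n) + 1) : ℕ) + 1) + ((2 ^ n / (n + 1) : ℕ) + 1) := by
    exact_mod_cast count_ne_encode_le b a n
  rw [Nat.cast_pow, Nat.cast_ofNat, ← add_div, ← add_div]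
  gcongr
  simp only [id]
  linarith

theorem count_encode_eq_one_le (b : ℕ → Fin 2) (a : ℕ → ℕ) (n : ℕ) :
    Nat.count (encode b a · = 1) (2 ^ n + 2 ^ n / (a (2 * n) + 1)) ≤
      Nat.count (encode b a · = 1) (2 ^ n) + (2 * n + 2) := by
  rw [Nat.count_add]
  refine Nat.add_le_add_left (count_le_of_forall_lt fun r hr hone => ?_) _
  by_contra! hrun
  have hpad : r * (a (2 * n) + 1) < 2 ^ n := by
    have hle : (r + 1) * (a (2 * n) + 1) ≤ 2 ^ n :=
      (Nat.le_div_iff_mul_le (Nat.succ_pos _)).1 hr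
    rw [add_one_mul] at hle
    omega
  have := plantedRun_le a n
  rw [encode_two_pow_add (hr.trans_le (Nat.div_le_self _ _)), stageDigit, if_neg (by omega),
    if_pos (.inl hpad)] at hone
  exact zero_ne_one hone

theorem mem_evenDivergent_of_encode (h : encode b a ∈ normalSeq) : a ∈ evenDivergent := by
  refine (tendsto_natDiv_div_iff tendsto_two_pow_atTop).1 ?_
  refine tendsto_gap_div_of_tendsto_average (by norm_num)
    (tendsto_count_digit_of_mem_normalSeq h 1) tendsto_two_pow_atTop
    (E := fun n => 2 * n + 2) ?_ (fun n => Nat.div_le_self _ _) fun n => ?_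
  · simpa using tendsto_linear_div_two_pow 2 2
  · exact_mod_cast count_encode_eq_one_le b a n

theorem encode_mem_normalSeq_iff (hb : b ∈ normalSeq) :
    encode b a ∈ normalSeq ↔ a ∈ evenDivergent :=
  ⟨mem_evenDivergent_of_encode, encode_mem_normalSeq hb⟩

end Encoding

end TypicalNumbers

theorem theoremB :
    (TypicalNumbers.TpcN \ TypicalNumbers.Normal).Nonempty ∧
    (TypicalNumbers.Normal \ TypicalNumbers.TpcN).Nonempty ∧
    TypicalNumbers.IsD2Pi0Complete 3 (TypicalNumbers.TpcN \ TypicalNumbers.Normal) ∧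
    TypicalNumbers.IsD2Pi0Complete 3 (TypicalNumbers.Normal \ TypicalNumbers.TpcN) ∧
    TypicalNumbers.IsD2Pi0Complete 3 (TypicalNumbers.typicalSeq \ TypicalNumbers.normalSeq) ∧
    TypicalNumbers.IsD2Pi0Complete 3 (TypicalNumbers.normalSeq \ TypicalNumbers.typicalSeq) ∧
    ∃ φ : (ℕ → ℕ) → (ℕ → Fin 2), Continuous φ ∧
      φ ⁻¹' (TypicalNumbers.normalSeq \ TypicalNumbers.typicalSeq) =
        TypicalNumbers.evenDivergent \ TypicalNumbers.oddDivergent ∧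
      φ ⁻¹' (TypicalNumbers.typicalSeq \ TypicalNumbers.normalSeq) =
        TypicalNumbers.oddDivergent \ TypicalNumbers.evenDivergent := by
  open TypicalNumbers in
  obtain ⟨b, hb⟩ := nonempty_normalSeq
  have hN : encode b ⁻¹' normalSeq = evenDivergent :=
    Set.ext fun _ => encode_mem_normalSeq_iff hb
  have hT : encode b ⁻¹' typicalSeq = oddDivergent :=
    Set.ext fun _ => encode_mem_typicalSeq_iff
  have hseq : IsPi0HardPair 3 normalSeq typicalSeq :=
    .of_preimage (continuous_encode b) (by rw [hN, hT]; exact isPi0HardPair_divergent)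
  have hnum : IsPi0HardPair 3 Normal TpcN :=
    .of_preimage continuous_toUnit (by rwa [toUnit_preimage_normal, toUnit_preimage_tpcN])
  have hTpcN := hnum.symm.isD2Pi0Complete_sdiff isPi0_tpcN isPi0_normal
  have hNormal := hnum.isD2Pi0Complete_sdiff isPi0_normal isPi0_tpcN
  refine ⟨hTpcN.nonempty, hNormal.nonempty, hTpcN, hNormal,
    hseq.symm.isD2Pi0Complete_sdiff isPi0_typicalSeq isPi0_normalSeq,
    hseq.isD2Pi0Complete_sdiff isPi0_normalSeq isPi0_typicalSeq,
    encode b, continuous_encode b, ?_, ?_⟩ <;>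
  rw [Set.preimage_sdiff, hN, hT]
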